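/- Let $W\subset \mathrm{GL}(\mathbb C^n)$ be a finite complex reflection group, that is, a finite subgroup generated by its set $R$ of reflections (the elements of $W$ whose fixed space in $\mathbb C^n$ is a hyperplane). For a reflecting hyperplane $H$ of $W$ (the fixed space of some $r\in R$) let $C_W(H)$ be the subgroup of elements of $W$ that fix $H$ pointwise. Let $S=\sum_{r\in R} r\in\mathbb C W$, and extend characters of $W$ linearly to $\mathbb C W$. For an irreducible complex character $\chi$ of $W$, the fake degree of $\chi$ is the polynomial $x^{e_1}+\dots+x^{e_{\chi(1)}}$ in which the coefficient of $x^d$ is the multiplicity of $\chi$ in the homogeneous component of degree $d$ of the coinvariant algebra of $W$ (the quotient of the algebra of polynomial functions on $\mathbb C^n$, with $(w\cdot f)(v)=f(w^{-1}v)$, by the ideal generated by the $W$-invariant polynomials with zero constant term). Write $\chi^*$ for the complex conjugate of $\chi$, and define $N$ on irreducible characters by $N(\chi^*)=\sum_{i=1}^{\chi(1)} e_i$. Assume that $|C_W(H)|$ has a common value $e$ for all reflecting hyperplanes $H$ of $W$. Then for every irreducible complex character $\chi$ of $W$, $$\chi(S)=|R|\,\chi(1)-N(\chi)-N(\chi^*).$$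 -/

import Mathlib

noncomputable section

namespace ReflectionGroup

open MvPolynomial

variable {n : ℕ}

/-! ### Reflections in `GL(ℂⁿ)` -/

/-- The subspace of `ℂⁿ` of vectors fixed by `g`. -/
def fixedSpace (g : GL (Fin n) ℂ) : Submodule ℂ (Fin n → ℂ) :=
  LinearMap.ker (Matrix.toLin' (g : Matrix (Fin n) (Fin n) ℂ) - LinearMap.id)

/-- `g` is a (complex) reflection if its fixed space is a hyperplane.  (In a finite group, such an
element is diagonalisable, with exactly one eigenvalue different from `1`.) -/
def IsReflection (g : GL (Fin n) ℂ) : Prop :=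
  Module.finrank ℂ (fixedSpace g) + 1 = n

/-- `W` is generated by the reflections that it contains.  A finite `W` with this property is a
complex reflection group. -/
def IsReflectionGroup (W : Subgroup (GL (Fin n) ℂ)) : Prop :=
  Subgroup.closure {g | g ∈ W ∧ IsReflection g} = W

open Classical in
/-- The set `R` of reflections of the finite group `W`. -/
def reflections (W : Subgroup (GL (Fin n) ℂ)) [Fintype W] : Finset W :=
  {w : W | IsReflection (w : GL (Fin n) ℂ)}

/-- The set `R*` of reflecting hyperplanes of `W`. -/
def reflectingHyperplanes (W : Subgroup (GL (Fin n) ℂ)) : Set (Submodule ℂ (Fin n → ℂ)) :=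
  {H | ∃ g ∈ W, IsReflection g ∧ fixedSpace g = H}

/-- The fixator `C_W(H)` of `H`: the elements of `W` that fix `H` pointwise. -/
def fixator (W : Subgroup (GL (Fin n) ℂ)) (H : Submodule ℂ (Fin n → ℂ)) : Set W :=
  {w | ∀ v ∈ H, ((w : GL (Fin n) ℂ) : Matrix (Fin n) (Fin n) ℂ).mulVec v = v}

/-- The element `S`, the sum of all reflections of `W`, of the group algebra `ℂW`. -/
def reflectionSum (W : Subgroup (GL (Fin n) ℂ)) [Fintype W] : MonoidAlgebra ℂ W :=
  ∑ r ∈ reflections W, MonoidAlgebra.of ℂ W r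

/-- The linear extension to the group algebra of a function on a finite group. -/
def linearExtension {G : Type*} [Fintype G] (χ : G → ℂ) (a : MonoidAlgebra ℂ G) : ℂ :=
  ∑ w, a.coeff w * χ w

/-! ### The coinvariant algebra -/

/-- The action of `g ∈ GL(ℂⁿ)` on polynomial functions on `ℂⁿ`, `(g • f)(v) = f (g⁻¹ v)`. -/
def polyAct (g : GL (Fin n) ℂ) : MvPolynomial (Fin n) ℂ →ₐ[ℂ] MvPolynomial (Fin n) ℂ :=
  aeval fun i => ∑ j, C ((g⁻¹ : GL (Fin n) ℂ) i j) * X j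

theorem eval_polyAct (g : GL (Fin n) ℂ) (f : MvPolynomial (Fin n) ℂ) (v : Fin n → ℂ) :
    eval v (polyAct g f)
      = eval (((g⁻¹ : GL (Fin n) ℂ) : Matrix (Fin n) (Fin n) ℂ).mulVec v) f := by
  induction f using MvPolynomial.induction_on with
  | C a => simp [polyAct]
  | add p q hp hq => simp [hp, hq]
  | mul_X p i hp =>
    rw [map_mul, map_mul, hp, map_mul]
    congr 1
    simp [polyAct, Matrix.mulVec, dotProduct]

theorem polyAct_mul (g h : GL (Fin n) ℂ) (f : MvPolynomial (Fin n) ℂ) :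
    polyAct (g * h) f = polyAct g (polyAct h f) := by
  apply MvPolynomial.funext
  intro v
  simp [eval_polyAct, Matrix.mulVec_mulVec]

theorem polyAct_one (f : MvPolynomial (Fin n) ℂ) : polyAct 1 f = f := by
  apply MvPolynomial.funext
  intro v
  simp [eval_polyAct]

theorem constantCoeff_polyAct (g : GL (Fin n) ℂ) (f : MvPolynomial (Fin n) ℂ) :
    constantCoeff (polyAct g f) = constantCoeff f := by
  have h := eval_polyAct g f 0
  simpa [Matrix.mulVec_zero, constantCoeff_eq, eval_zero] using h

theorem polyAct_isHomogeneous (g : GL (Fin n) ℂ) {f : MvPolynomial (Fin n) ℂ} {d : ℕ}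
    (hf : f.IsHomogeneous d) : (polyAct g f).IsHomogeneous d := by
  have h := hf.aeval (fun i => ∑ j, C ((g⁻¹ : GL (Fin n) ℂ) i j) * X j) (n := 1) fun i =>
    IsHomogeneous.sum _ _ _ fun j _ => isHomogeneous_C_mul_X _ j
  simpa [polyAct] using h

/-- The ideal of the polynomial ring generated by the `W`-invariant polynomials with zero constant
term. -/
def invariantIdeal (W : Subgroup (GL (Fin n) ℂ)) : Ideal (MvPolynomial (Fin n) ℂ) :=
  Ideal.span {f | (∀ w ∈ W, polyAct w f = f) ∧ constantCoeff f = 0}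

theorem polyAct_mem_invariantIdeal {W : Subgroup (GL (Fin n) ℂ)} (w : W) :
    invariantIdeal W ≤ (invariantIdeal W).comap (polyAct (w : GL (Fin n) ℂ)) := by
  refine Ideal.span_le.2 fun f hf => ?_
  change polyAct (w : GL (Fin n) ℂ) f ∈ invariantIdeal W
  rw [hf.1 w w.2]
  exact Ideal.subset_span hf

/-- The coinvariant algebra of `W`. -/
abbrev CoinvariantAlgebra (W : Subgroup (GL (Fin n) ℂ)) : Type :=
  MvPolynomial (Fin n) ℂ ⧸ invariantIdeal W

/-- The action of `W` on its coinvariant algebra. -/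
def coinvariantAct (W : Subgroup (GL (Fin n) ℂ)) (w : W) :
    CoinvariantAlgebra W →ₐ[ℂ] CoinvariantAlgebra W :=
  Ideal.quotientMapₐ (invariantIdeal W) (polyAct (w : GL (Fin n) ℂ)) (polyAct_mem_invariantIdeal w)

/-- The homogeneous component of degree `d` of the coinvariant algebra of `W`. -/
def coinvariantPiece (W : Subgroup (GL (Fin n) ℂ)) (d : ℕ) : Submodule ℂ (CoinvariantAlgebra W) :=
  (homogeneousSubmodule (Fin n) ℂ d).map (Ideal.Quotient.mkₐ ℂ (invariantIdeal W)).toLinearMap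

theorem coinvariantAct_mem (W : Subgroup (GL (Fin n) ℂ)) (d : ℕ) (w : W) :
    ∀ a ∈ coinvariantPiece W d, (coinvariantAct W w).toLinearMap a ∈ coinvariantPiece W d := by
  rintro _ ⟨f, hf, rfl⟩
  exact ⟨polyAct (w : GL (Fin n) ℂ) f, polyAct_isHomogeneous _ hf, rfl⟩

/-- The representation of `W` on the component of degree `d` of its coinvariant algebra. -/
def coinvariantRep (W : Subgroup (GL (Fin n) ℂ)) (d : ℕ) :
    Representation ℂ W (coinvariantPiece W d) where
  toFun w := (coinvariantAct W w).toLinearMap.restrict (coinvariantAct_mem W d w)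
  map_one' := by
    ext ⟨_, f, hf, rfl⟩
    change Ideal.Quotient.mk (invariantIdeal W) (polyAct 1 f) = Ideal.Quotient.mk _ f
    rw [polyAct_one]
  map_mul' g h := by
    ext ⟨_, f, hf, rfl⟩
    change Ideal.Quotient.mk (invariantIdeal W) (polyAct (g * h : GL (Fin n) ℂ) f)
      = Ideal.Quotient.mk _ (polyAct (g : GL (Fin n) ℂ) (polyAct (h : GL (Fin n) ℂ) f))
    rw [polyAct_mul]

/-- A product of `|W|` polynomials without constant term lies in the ideal generated by the
invariants without constant term. -/
theorem prod_mem_invariantIdeal (W : Subgroup (GL (Fin n) ℂ)) [Fintype W]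
    (f : W → MvPolynomial (Fin n) ℂ) (hf : ∀ w, constantCoeff (f w) = 0) :
    ∏ w, f w ∈ invariantIdeal W := by
  classical
  have key : ∀ h : W, ∑ t : Finset W,
      (∏ a ∈ t, polyAct ((h * a : W) : GL (Fin n) ℂ) (f a)) * ∏ a ∈ tᶜ, -f a = 0 := by
    intro h
    rw [← Fintype.prod_add]
    refine Finset.prod_eq_zero (Finset.mem_univ h⁻¹) ?_
    rw [mul_inv_cancel, Subgroup.coe_one, polyAct_one, add_neg_cancel]
  have hsum : ∑ t : Finset W,
      (∑ h : W, ∏ a ∈ t, polyAct ((h * a : W) : GL (Fin n) ℂ) (f a)) * ∏ a ∈ tᶜ, -f a = 0 := by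
    simp_rw [Finset.sum_mul]
    rw [Finset.sum_comm]
    exact Finset.sum_eq_zero fun h _ => key h
  have hmem : ∀ t : Finset W, t ≠ ∅ →
      (∑ h : W, ∏ a ∈ t, polyAct ((h * a : W) : GL (Fin n) ℂ) (f a)) * ∏ a ∈ tᶜ, -f a
        ∈ invariantIdeal W := by
    intro t ht
    refine Ideal.mul_mem_right _ _ (Ideal.subset_span ⟨fun w hw => ?_, ?_⟩)
    · rw [map_sum, ← Equiv.sum_comp (Equiv.mulLeft (⟨w, hw⟩ : W))
        (fun h => ∏ a ∈ t, polyAct ((h * a : W) : GL (Fin n) ℂ) (f a))]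
      refine Finset.sum_congr rfl fun h _ => ?_
      rw [map_prod]
      refine Finset.prod_congr rfl fun a _ => ?_
      rw [← polyAct_mul]
      simp [mul_assoc]
    · obtain ⟨a, ha⟩ := Finset.nonempty_iff_ne_empty.2 ht
      rw [map_sum]
      refine Finset.sum_eq_zero fun h _ => ?_
      rw [map_prod]
      exact Finset.prod_eq_zero ha (by rw [constantCoeff_polyAct, hf])
  rw [← Finset.add_sum_erase _ _ (Finset.mem_univ ∅)] at hsum
  have h1 : (∑ h : W, ∏ a ∈ (∅ : Finset W), polyAct ((h * a : W) : GL (Fin n) ℂ) (f a))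
      * ∏ a ∈ (∅ : Finset W)ᶜ, -f a ∈ invariantIdeal W := by
    rw [eq_neg_of_add_eq_zero_left hsum]
    exact neg_mem (sum_mem fun t ht => hmem t (Finset.ne_of_mem_erase ht))
  have h2 : ∏ w, f w = (C ((Fintype.card W : ℂ)⁻¹) * (-1) ^ Fintype.card W) *
      ((∑ h : W, ∏ a ∈ (∅ : Finset W), polyAct ((h * a : W) : GL (Fin n) ℂ) (f a))
      * ∏ a ∈ (∅ : Finset W)ᶜ, -f a) := by
    have hc : (C ((Fintype.card W : ℂ)⁻¹) : MvPolynomial (Fin n) ℂ) * (Fintype.card W : ℕ) = 1 := by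
      rw [← map_natCast (C : ℂ →+* MvPolynomial (Fin n) ℂ), ← map_mul,
        inv_mul_cancel₀ (Nat.cast_ne_zero.2 Fintype.card_ne_zero), map_one]
    have hs : ((-1 : MvPolynomial (Fin n) ℂ)) ^ Fintype.card W * (-1) ^ Fintype.card W = 1 := by
      rw [← mul_pow]; simp
    simp only [Finset.prod_empty, Finset.sum_const, Finset.card_univ, nsmul_eq_mul, mul_one,
      Finset.compl_empty, Finset.prod_neg]
    linear_combination
      (-∏ w, f w) * hs - (∏ w, f w) * (-1) ^ Fintype.card W * (-1) ^ Fintype.card W * hc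
  rw [h2]
  exact Ideal.mul_mem_left _ _ h1

theorem monomial_mem_invariantIdeal (W : Subgroup (GL (Fin n) ℂ)) [Fintype W] (m : Fin n →₀ ℕ)
    (hm : Fintype.card W ≤ m.degree) (c : ℂ) : monomial m c ∈ invariantIdeal W := by
  have hl : (Finsupp.toMultiset m).toList.length = m.degree := by
    rw [Multiset.length_toList, Finsupp.card_toMultiset]; rfl
  set l := (Finsupp.toMultiset m).toList with hldef
  have hprod : (monomial m c : MvPolynomial (Fin n) ℂ) = C c * (l.map X).prod := by
    rw [← Multiset.prod_coe, ← Multiset.map_coe, hldef, Multiset.coe_toList,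
      Finsupp.toMultiset_map, Finsupp.prod_toMultiset]
    rw [MvPolynomial.monomial_eq, Finsupp.prod_mapDomain_index (by simp) (by simp [pow_add])]
  rw [hprod, ← List.take_append_drop (Fintype.card W) l, List.map_append, List.prod_append]
  refine Ideal.mul_mem_left _ _ (Ideal.mul_mem_right _ _ ?_)
  have hlen : (l.take (Fintype.card W)).length = Fintype.card W := by
    rw [List.length_take, hl]; exact min_eq_left hm
  have e : W ≃ Fin (l.take (Fintype.card W)).length :=
    Fintype.equivOfCardEq (by rw [Fintype.card_fin, hlen])
  rw [← Fin.prod_univ_fun_getElem, ← e.prod_comp]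
  exact prod_mem_invariantIdeal W _ fun w => constantCoeff_X _ _

/-- The coinvariant algebra vanishes in degrees at least `|W|`. -/
theorem coinvariantPiece_eq_bot (W : Subgroup (GL (Fin n) ℂ)) [Fintype W] {d : ℕ}
    (hd : Fintype.card W ≤ d) : coinvariantPiece W d = ⊥ := by
  rw [eq_bot_iff]
  rintro _ ⟨f, hf, rfl⟩
  refine (Submodule.mem_bot ℂ).2 (Ideal.Quotient.eq_zero_iff_mem.2 ?_)
  rw [MvPolynomial.as_sum f]
  refine sum_mem fun m hm => monomial_mem_invariantIdeal W m ?_ _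
  have h := hf (mem_support_iff.1 hm)
  rw [Finsupp.degree_eq_weight_one]
  exact hd.trans_eq h.symm

/-! ### Fake degrees -/

/-- The scalar product `|W|⁻¹ ∑ conj (χ w) · ψ w`.  If `χ` is an irreducible character, and `ψ` is
the character of a representation, then it is the multiplicity of `χ` in that representation. -/
def multiplicity {G : Type*} [Fintype G] (χ ψ : G → ℂ) : ℂ :=
  (Fintype.card G : ℂ)⁻¹ * ∑ w, starRingEnd ℂ (χ w) * ψ w

/-- The fake degree of the irreducible character `χ`: the polynomial in which the coefficient of
`x ^ d` is the multiplicity of `χ` in the component of degree `d` of the coinvariant algebra.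
This component is zero for `d ≥ |W|`, so no degree is left out. -/
def fakeDegree (W : Subgroup (GL (Fin n) ℂ)) [Fintype W] (χ : W → ℂ) : Polynomial ℂ :=
  ∑ d ∈ Finset.range (Fintype.card W),
    Polynomial.monomial d (multiplicity χ (coinvariantRep W d).character)

/-- The coefficient of `x ^ d` in the fake degree is, in every degree `d`, the multiplicity of `χ`
in the component of degree `d`. -/
theorem coeff_fakeDegree (W : Subgroup (GL (Fin n) ℂ)) [Fintype W] (χ : W → ℂ) (d : ℕ) :
    (fakeDegree W χ).coeff d = multiplicity χ (coinvariantRep W d).character := by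
  simp only [fakeDegree, Polynomial.finsetSum_coeff, Polynomial.coeff_monomial,
    Finset.sum_ite_eq', Finset.mem_range]
  split_ifs with h
  · rfl
  · have hb := coinvariantPiece_eq_bot W (not_lt.1 h)
    have : Subsingleton (coinvariantPiece W d) := by rw [hb]; infer_instance
    have h0 : ∀ w, (coinvariantRep W d).character w = 0 := fun w => by
      rw [Representation.character, Subsingleton.elim (coinvariantRep W d w) 0, map_zero]
    simp [multiplicity, h0]

/-- The sum of the exponents of a polynomial `x ^ e₁ + ⋯ + x ^ eₖ`: each exponent counts with its
coefficient as its multiplicity. -/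
def exponentSum (P : Polynomial ℂ) : ℂ :=
  P.sum fun d c => c * d

theorem exponentSum_sum_X_pow {k : ℕ} (e : Fin k → ℕ) :
    exponentSum (∑ i, Polynomial.X ^ e i) = ∑ i, (e i : ℂ) := by
  have h : ∀ P : Polynomial ℂ, exponentSum P = P.derivative.eval 1 := fun P => by
    simp [exponentSum, Polynomial.derivative_eval]
  rw [h, Polynomial.derivative_sum, Polynomial.eval_finsetSum]
  exact Finset.sum_congr rfl fun i _ => by simp [Polynomial.derivative_X_pow]

/-- `N(χ)`, normalised so that `N(χ*)` is the sum of the exponents of the fake degree of `χ`, where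
`χ*` is the complex conjugate of `χ`. -/
def N (W : Subgroup (GL (Fin n) ℂ)) [Fintype W] (χ : W → ℂ) : ℂ :=
  exponentSum (fakeDegree W (star χ))

end ReflectionGroup

end

namespace ReflectionGroup

open MvPolynomial

variable {n : ℕ}

/-! Let `G_w(x)` be the graded trace of `w` on the coinvariant algebra. Orthogonality turns the sum
of the exponents of a fake degree into a combination of the derivatives `G_w'(1)`, namely `N(χ) =
|W|⁻¹ ∑ χ(w) G_w'(1)`. Replacing `w` by `w⁻¹` gives `N(χ) + N(χ*) = |W|⁻¹ ∑ χ(w) (G_w'(1) +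
G_{w⁻¹}'(1))`, so only the symmetrised derivatives matter.

By Chevalley, the polynomial ring is, as a graded representation, the tensor product of the
invariants and the coinvariant algebra (`coeff_eq_zero_of_relation`, `character_polyRep`). Together
with Molien's formula this gives `G_w(x) ∏ (1 - z_i x) = G_1(x) (1 - x)^n`, where the `z_i` are the
eigenvalues of `w⁻¹` (`gradedTrace_mul_prod`). Hence `G_w` vanishes at `1` for `w ≠ 1`, doubly if
`w` is not a reflection. For a reflection with `c = det w⁻¹`, `G_w'(1) = -G_1(1) / (1 - c)`, and `1
/ (1 - c) + 1 / (1 - c⁻¹) = 1` removes the dependence on `c` after symmetrisation.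

The constants come from `∑ G_w = |W|`, since the coinvariant algebra has invariants only in degree
zero: evaluation and differentiation at `1` give `G_1(1) = |W|` and `2 G_1'(1) = |W| |R|`. -/

/-! ### Invariants and averaging over the group. -/

/-- The algebra of `W`-invariant polynomials. -/
noncomputable def invariants (W : Subgroup (GL (Fin n) ℂ)) : Subalgebra ℂ (MvPolynomial (Fin n) ℂ) :=
  ⨅ w ∈ W, AlgHom.equalizer (polyAct w) (AlgHom.id ℂ _)

theorem mem_invariants {W : Subgroup (GL (Fin n) ℂ)} {f : MvPolynomial (Fin n) ℂ} :
    f ∈ invariants W ↔ ∀ w ∈ W, polyAct w f = f := by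
  simp [invariants, Algebra.mem_iInf]

theorem mem_invariantIdeal_of_invariant {W : Subgroup (GL (Fin n) ℂ)}
    {f : MvPolynomial (Fin n) ℂ} (hf : f ∈ invariants W) (h0 : constantCoeff f = 0) :
    f ∈ invariantIdeal W :=
  Ideal.subset_span ⟨mem_invariants.1 hf, h0⟩

theorem constantCoeff_eq_zero_of_mem {W : Subgroup (GL (Fin n) ℂ)}
    {f : MvPolynomial (Fin n) ℂ} (hf : f ∈ invariantIdeal W) : constantCoeff f = 0 := by
  have h : invariantIdeal W ≤ RingHom.ker (constantCoeff (R := ℂ) (σ := Fin n)) :=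
    Ideal.span_le.2 fun f hf => hf.2
  exact h hf

/-- The Reynolds operator. -/
noncomputable def average (W : Subgroup (GL (Fin n) ℂ)) [Fintype W] :
    MvPolynomial (Fin n) ℂ →ₗ[ℂ] MvPolynomial (Fin n) ℂ :=
  (Fintype.card W : ℂ)⁻¹ • ∑ w : W, (polyAct (w : GL (Fin n) ℂ)).toLinearMap

section Average

variable (W : Subgroup (GL (Fin n) ℂ)) [Fintype W]

theorem average_apply (f : MvPolynomial (Fin n) ℂ) :
    average W f = (Fintype.card W : ℂ)⁻¹ • ∑ w : W, polyAct (w : GL (Fin n) ℂ) f := by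
  simp [average]

theorem average_mem (f : MvPolynomial (Fin n) ℂ) : average W f ∈ invariants W := by
  refine mem_invariants.2 fun w hw => ?_
  rw [average_apply, map_smul, map_sum,
    ← Equiv.sum_comp (Equiv.mulLeft (⟨w, hw⟩ : W)) (fun v : W => polyAct (v : GL (Fin n) ℂ) f)]
  simp [polyAct_mul]

theorem average_mul {g : MvPolynomial (Fin n) ℂ} (hg : g ∈ invariants W)
    (f : MvPolynomial (Fin n) ℂ) : average W (g * f) = g * average W f := by
  simp only [average_apply, map_mul, mul_smul_comm, Finset.mul_sum]
  simp_rw [mem_invariants.1 hg _ (Subtype.prop _)]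

/-- The difference is the mean of the `polyAct w f - f`. With it, membership of `f` in `J` follows
from that of its average once `W` fixes `f` modulo `J`. -/
theorem sub_average_mem {J : Ideal (MvPolynomial (Fin n) ℂ)} {f : MvPolynomial (Fin n) ℂ}
    (h : ∀ w ∈ W, polyAct w f - f ∈ J) : average W f - f ∈ J := by
  have hc : (Fintype.card W : ℂ) ≠ 0 := Nat.cast_ne_zero.2 Fintype.card_ne_zero
  have : average W f - f
      = C (Fintype.card W : ℂ)⁻¹ * ∑ w : W, (polyAct (w : GL (Fin n) ℂ) f - f) := by
    rw [average_apply, Finset.sum_sub_distrib, ← smul_eq_C_mul, smul_sub, Finset.sum_const,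
      Finset.card_univ, ← Nat.cast_smul_eq_nsmul ℂ, smul_smul, inv_mul_cancel₀ hc, one_smul]
  rw [this]
  exact Ideal.mul_mem_left _ _ (sum_mem fun w _ => h w w.2)

theorem sum_polyAct_mem_invariantIdeal {f : MvPolynomial (Fin n) ℂ} (h0 : constantCoeff f = 0) :
    ∑ w : W, polyAct (w : GL (Fin n) ℂ) f ∈ invariantIdeal W := by
  have hc : (Fintype.card W : ℂ) ≠ 0 := Nat.cast_ne_zero.2 Fintype.card_ne_zero
  refine mem_invariantIdeal_of_invariant ?_ ?_
  · have := (invariants W).smul_mem (average_mem W f) (Fintype.card W : ℂ)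
    rwa [average_apply, smul_inv_smul₀ hc] at this
  · simp [constantCoeff_polyAct, h0]

end Average

/-! ### Diagonalisation -/

/-- An endomorphism of finite order has a basis of eigenvectors. -/
theorem exists_basis_eigenvectors {V : Type*} [AddCommGroup V] [Module ℂ V] [FiniteDimensional ℂ V]
    (f : Module.End ℂ V) {m : ℕ} (hm : m ≠ 0) (hf : f ^ m = 1) :
    ∃ (b : Module.Basis (Fin (Module.finrank ℂ V)) ℂ V) (z : Fin (Module.finrank ℂ V) → ℂ),
      ∀ i, f (b i) = z i • b i := by
  have hs : f.IsSemisimple := by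
    refine Module.End.isSemisimple_of_squarefree_aeval_eq_zero (p := Polynomial.X ^ m - 1) ?_ ?_
    · have := (Polynomial.separable_X_pow_sub_C (1 : ℂ) (Nat.cast_ne_zero.2 hm) one_ne_zero)
      simpa using this.squarefree
    · simp [hf]
  have ht : ⊤ ≤ Submodule.span ℂ {v : V | ∃ z : ℂ, f v = z • v} := by
    rw [← hs.iSup_eigenspace_eq_top]
    exact iSup_le fun z v hv => Submodule.subset_span ⟨z, Module.End.mem_eigenspace_iff.1 hv⟩
  let b := Module.Basis.ofSpan ht
  have : Fintype ((linearIndepOn_empty ℂ id).extend (Set.empty_subset {v : V | ∃ z : ℂ, f v = z • v})) :=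
    FiniteDimensional.fintypeBasisIndex b
  have hb : ∀ i, ∃ z : ℂ, f (b i) = z • b i := fun i =>
    Module.Basis.ofSpan_subset ht ⟨i, rfl⟩
  choose z hz using hb
  let e := Fintype.equivFinOfCardEq (Module.finrank_eq_card_basis b).symm
  exact ⟨b.reindex e, z ∘ e.symm, fun i => by simp [hz]⟩

theorem trace_eq_sum_of_eigenbasis {ι V : Type*} [Fintype ι] [AddCommGroup V] [Module ℂ V]
    (b : Module.Basis ι ℂ V) (z : ι → ℂ) (f : V →ₗ[ℂ] V) (h : ∀ i, f (b i) = z i • b i) :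
    LinearMap.trace ℂ V f = ∑ i, z i := by
  classical
  rw [LinearMap.trace_eq_matrix_trace ℂ b, Matrix.trace]
  exact Finset.sum_congr rfl fun i _ => by simp [LinearMap.toMatrix_apply, h]

/-- The eigenvalues of `ρ g` are roots of unity, for which conjugation is inversion. -/
theorem star_character {G V : Type*} [Group G] [Finite G] [AddCommGroup V] [Module ℂ V]
    [FiniteDimensional ℂ V] (ρ : Representation ℂ G V) (g : G) :
    starRingEnd ℂ (ρ.character g) = ρ.character g⁻¹ := by
  have hm : orderOf g ≠ 0 := (orderOf_pos g).ne'
  have hg : ρ g ^ orderOf g = 1 := by rw [← map_pow, pow_orderOf_eq_one, map_one]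
  obtain ⟨b, z, hz⟩ := exists_basis_eigenvectors (ρ g) hm hg
  have hz1 : ∀ i, z i ^ orderOf g = 1 := fun i => by
    have h : ∀ k : ℕ, (ρ g ^ k) (b i) = z i ^ k • b i := fun k => by
      induction k with
      | zero => simp
      | succ k ih => rw [pow_succ', Module.End.mul_apply, ih, map_smul, hz, smul_smul, pow_succ]
    have h1 := h (orderOf g)
    rw [hg, Module.End.one_apply] at h1
    exact (smul_left_injective ℂ (b.ne_zero i) (by simpa using h1)).symm
  have hn : ∀ i, z i ≠ 0 := fun i h => by simpa [h, hm] using hz1 i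
  have hinv : ∀ i, ρ g⁻¹ (b i) = (z i)⁻¹ • b i := fun i => by
    have h : ρ g⁻¹ (ρ g (b i)) = b i := by
      rw [← Module.End.mul_apply, ← map_mul, inv_mul_cancel, map_one, Module.End.one_apply]
    rw [hz, map_smul] at h
    rw [← h, smul_smul, inv_mul_cancel₀ (hn i), one_smul]
    rw [h]
  rw [Representation.character, Representation.character, trace_eq_sum_of_eigenbasis b z _ hz,
    trace_eq_sum_of_eigenbasis b _ _ hinv, map_sum]
  refine Finset.sum_congr rfl fun i _ => ?_
  rw [Complex.inv_eq_conj (Complex.norm_eq_one_of_pow_eq_one (hz1 i) hm)]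

/-- An element of a finite subgroup of `GL(ℂⁿ)` is diagonalisable. -/
theorem exists_diagonalization {g : GL (Fin n) ℂ} (hg : IsOfFinOrder g) :
    ∃ (Q : GL (Fin n) ℂ) (z : Fin n → ℂ),
      (g : Matrix (Fin n) (Fin n) ℂ) = Q * Matrix.diagonal z * (Q⁻¹ : GL (Fin n) ℂ) := by
  have hm : orderOf g ≠ 0 := hg.orderOf_pos.ne'
  obtain ⟨b, z, hz⟩ := exists_basis_eigenvectors (Matrix.toLin' (g : Matrix (Fin n) (Fin n) ℂ)) hm
    (by rw [← Matrix.toLin'_pow, ← Units.val_pow_eq_pow_val, pow_orderOf_eq_one]; simp; rfl)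
  let e : Fin (Module.finrank ℂ (Fin n → ℂ)) ≃ Fin n := finCongr (by simp)
  let b' := b.reindex e
  have hz' : ∀ i, Matrix.toLin' (g : Matrix (Fin n) (Fin n) ℂ) (b' i) = z (e.symm i) • b' i :=
    fun i => by simp [b', hz, -Matrix.toLin'_apply]
  let c := Pi.basisFun ℂ (Fin n)
  let Q : GL (Fin n) ℂ := ⟨c.toMatrix b', b'.toMatrix c, c.toMatrix_mul_toMatrix_flip b',
    b'.toMatrix_mul_toMatrix_flip c⟩
  refine ⟨Q, z ∘ e.symm, ?_⟩
  have h : (g : Matrix (Fin n) (Fin n) ℂ) * Q = Q * Matrix.diagonal (z ∘ e.symm) := by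
    ext i j
    have := congrFun (hz' j) i
    rw [Matrix.mul_diagonal]
    simpa [Q, Matrix.mul_apply, Module.Basis.toMatrix_apply, c, Matrix.mulVec, dotProduct,
      mul_comm] using this
  rw [← h, mul_assoc, ← Units.val_mul, mul_inv_cancel, Units.val_one, mul_one]

/-! ### Roots of reflections -/

theorem fixedSpace_inv (g : GL (Fin n) ℂ) : fixedSpace g⁻¹ = fixedSpace g := by
  have h : ∀ g : GL (Fin n) ℂ, fixedSpace g ≤ fixedSpace g⁻¹ := fun g v hv => by
    simp only [fixedSpace, LinearMap.mem_ker, LinearMap.sub_apply, Matrix.toLin'_apply,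
      LinearMap.id_apply, sub_eq_zero] at hv ⊢
    nth_rw 1 [← hv]
    rw [Matrix.mulVec_mulVec, ← Units.val_mul, inv_mul_cancel, Units.val_one, Matrix.one_mulVec]
  exact le_antisymm (by simpa using h g⁻¹) (h g)

theorem conj_diagonal_sub_one (Q : GL (Fin n) ℂ) (z : Fin n → ℂ) :
    (Q : Matrix (Fin n) (Fin n) ℂ) * Matrix.diagonal z * (Q⁻¹ : GL (Fin n) ℂ) - 1
      = Q * Matrix.diagonal (fun i => z i - 1) * (Q⁻¹ : GL (Fin n) ℂ) := by
  have h1 : (1 : Matrix (Fin n) (Fin n) ℂ) = Q * 1 * (Q⁻¹ : GL (Fin n) ℂ) := by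
    rw [mul_one, ← Units.val_mul, mul_inv_cancel, Units.val_one]
  have h2 : Matrix.diagonal (fun i => z i - 1) = Matrix.diagonal z - 1 := by
    rw [← Matrix.diagonal_one, Matrix.diagonal_sub]
  nth_rw 1 [h1]
  rw [h2, mul_sub, sub_mul]

/-- It is `g⁻¹` that is diagonalised, because polynomials are acted on through the inverse; the
fixed space is the same. Its codimension is the rank of `diag (z - 1)`. -/
theorem finrank_fixedSpace_add {g Q : GL (Fin n) ℂ} {z : Fin n → ℂ}
    (h : ((g⁻¹ : GL (Fin n) ℂ) : Matrix (Fin n) (Fin n) ℂ)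
      = Q * Matrix.diagonal z * (Q⁻¹ : GL (Fin n) ℂ)) :
    Module.finrank ℂ (fixedSpace g) + Fintype.card {i // z i ≠ 1} = n := by
  classical
  have h1 : fixedSpace g = LinearMap.ker (Matrix.toLin' ((Q : Matrix (Fin n) (Fin n) ℂ) *
      Matrix.diagonal (fun i => z i - 1) * ((Q⁻¹ : GL (Fin n) ℂ) : Matrix (Fin n) (Fin n) ℂ))) := by
    rw [← fixedSpace_inv, fixedSpace, h, ← conj_diagonal_sub_one, map_sub, Matrix.toLin'_one]
  have h2 := LinearMap.finrank_range_add_finrank_ker (Matrix.toLin' ((Q : Matrix (Fin n) (Fin n) ℂ) *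
      Matrix.diagonal (fun i => z i - 1) * ((Q⁻¹ : GL (Fin n) ℂ) : Matrix (Fin n) (Fin n) ℂ)))
  have h3 : ∀ P : GL (Fin n) ℂ, IsUnit (P : Matrix (Fin n) (Fin n) ℂ).det :=
    fun P => (Matrix.isUnit_iff_isUnit_det _).1 P.isUnit
  have h4 : Module.finrank ℂ (LinearMap.range (Matrix.toLin' ((Q : Matrix (Fin n) (Fin n) ℂ) *
      Matrix.diagonal (fun i => z i - 1) * ((Q⁻¹ : GL (Fin n) ℂ) : Matrix (Fin n) (Fin n) ℂ))))
      = Fintype.card {i // z i ≠ 1} := by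
    change Matrix.rank _ = _
    rw [Matrix.rank_mul_eq_left_of_isUnit_det _ _ (h3 _),
      Matrix.rank_mul_eq_right_of_isUnit_det _ _ (h3 _), Matrix.rank_diagonal]
    simp only [ne_eq, sub_eq_zero]
  rw [h1, ← h4, add_comm, h2]
  simp

theorem isReflection_iff_exists {g Q : GL (Fin n) ℂ} {z : Fin n → ℂ}
    (h : ((g⁻¹ : GL (Fin n) ℂ) : Matrix (Fin n) (Fin n) ℂ)
      = Q * Matrix.diagonal z * (Q⁻¹ : GL (Fin n) ℂ)) :
    IsReflection g ↔ ∃ i, z i ≠ 1 ∧ ∀ j, j ≠ i → z j = 1 := by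
  have h1 := finrank_fixedSpace_add h
  have h2 : IsReflection g ↔ Fintype.card {i // z i ≠ 1} = 1 := by
    rw [IsReflection]; omega
  rw [h2, Fintype.card_eq_one_iff]
  constructor
  · rintro ⟨⟨i, hi⟩, hu⟩
    exact ⟨i, hi, fun j hj => by_contra fun hz => hj (congrArg Subtype.val (hu ⟨j, hz⟩))⟩
  · rintro ⟨i, hi, hu⟩
    exact ⟨⟨i, hi⟩, fun j => Subtype.ext (by_contra fun hj => j.2 (hu _ hj))⟩

/-- A reflection `g` of finite order acts trivially modulo the linear form that defines its
hyperplane. -/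
theorem exists_dvd_polyAct_sub {g : GL (Fin n) ℂ} (hg : IsOfFinOrder g) (hr : IsReflection g) :
    ∃ l : MvPolynomial (Fin n) ℂ, l ≠ 0 ∧ l.IsHomogeneous 1 ∧ ∀ f, l ∣ polyAct g f - f := by
  obtain ⟨Q, z, hz⟩ := exists_diagonalization hg.inv
  obtain ⟨a, ha, hu⟩ := (isReflection_iff_exists hz).1 hr
  -- Only the `a`-th diagonal entry of `z - 1` survives, so `g⁻¹ - 1` has rank one; row `a` of `Q⁻¹`
  -- is the linear form sought.
  have hent : ∀ i j, ((g⁻¹ : GL (Fin n) ℂ) : Matrix (Fin n) (Fin n) ℂ) i j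
      = (1 : Matrix (Fin n) (Fin n) ℂ) i j
        + Q i a * (z a - 1) * (Q⁻¹ : GL (Fin n) ℂ) a j := fun i j => by
    have h := conj_diagonal_sub_one Q z
    rw [← hz] at h
    rw [eq_add_of_sub_eq' h, Matrix.add_apply, Matrix.mul_apply]
    congr 1
    rw [Finset.sum_eq_single a (fun b _ hb => by simp [Matrix.mul_diagonal, hu b hb]) (by simp),
      Matrix.mul_diagonal]
  let l : MvPolynomial (Fin n) ℂ :=
    ∑ j, C (((Q⁻¹ : GL (Fin n) ℂ) : Matrix (Fin n) (Fin n) ℂ) a j) * X j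
  have hX : ∀ i, polyAct g (X i) - X i = C (Q i a * (z a - 1)) * l := fun i => by
    have h1 : ∑ j, C ((1 : Matrix (Fin n) (Fin n) ℂ) i j) * X j
        = (X i : MvPolynomial (Fin n) ℂ) := by
      rw [Finset.sum_eq_single i (fun b _ hb => by simp [Matrix.one_apply_ne hb.symm]) (by simp)]
      simp
    simp only [polyAct, aeval_X, hent, map_add, add_mul, Finset.sum_add_distrib, h1,
      add_sub_cancel_left, l, Finset.mul_sum, map_mul, mul_assoc]
  refine ⟨l, fun h0 => ha ?_, IsHomogeneous.sum _ _ _ fun j _ => isHomogeneous_C_mul_X _ j, ?_⟩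
  · have hg1 : ((g⁻¹ : GL (Fin n) ℂ) : Matrix (Fin n) (Fin n) ℂ) = 1 := by
      ext i j
      have hc : ∀ j, ((Q⁻¹ : GL (Fin n) ℂ) : Matrix (Fin n) (Fin n) ℂ) a j = 0 := fun j => by
        have := congrArg (coeff (Finsupp.single j 1)) h0
        simpa [l, coeff_sum, coeff_C_mul, coeff_X, Finsupp.single_left_inj] using this
      rw [hent, hc, mul_zero, add_zero]
    have h2 : Matrix.diagonal z = 1 := by
      have h3 : (Q⁻¹ : GL (Fin n) ℂ) * (1 : Matrix (Fin n) (Fin n) ℂ) * Q = Matrix.diagonal z := by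
        rw [← hg1, hz, ← mul_assoc, ← mul_assoc, ← Units.val_mul, inv_mul_cancel, mul_assoc,
          ← Units.val_mul, inv_mul_cancel, Units.val_one, one_mul, mul_one]
      rw [← h3, mul_one, ← Units.val_mul, inv_mul_cancel, Units.val_one]
    simpa using congrFun (congrFun h2 a) a
  · intro f
    induction f using MvPolynomial.induction_on with
    | C c => simp [polyAct]
    | add p q hp hq => rw [map_add, add_sub_add_comm]; exact dvd_add hp hq
    | mul_X p i hp =>
      -- Twisted Leibniz rule: divisibility on the variables propagates to all products.
      have : polyAct g (p * X i) - p * X i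
          = polyAct g p * (polyAct g (X i) - X i) + (polyAct g p - p) * X i := by
        rw [map_mul]; ring
      rw [this, hX]
      exact dvd_add (Dvd.intro_left _ (by rw [mul_assoc])) (hp.mul_right _)

theorem totalDegree_polyAct_le (g : GL (Fin n) ℂ) (f : MvPolynomial (Fin n) ℂ) :
    (polyAct g f).totalDegree ≤ f.totalDegree := by
  rw [← sum_homogeneousComponent f, map_sum, sum_homogeneousComponent f]
  refine totalDegree_finsetSum_le fun i hi => ?_
  exact (polyAct_isHomogeneous g (homogeneousComponent_isHomogeneous i f)).totalDegree_le.trans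
    (Nat.lt_succ_iff.1 (Finset.mem_range.1 hi))

/-! ### Freeness over the invariants -/

section Freeness

variable {W : Subgroup (GL (Fin n) ℂ)}

/-- The elements of `W` that fix `f` modulo a `W`-stable ideal form a subgroup. This is where
generation by reflections enters. -/
theorem polyAct_sub_mem (hW : IsReflectionGroup W) {J : Ideal (MvPolynomial (Fin n) ℂ)}
    (hJ : ∀ w ∈ W, J ≤ J.comap (polyAct w)) {f : MvPolynomial (Fin n) ℂ}
    (hf : ∀ r ∈ W, IsReflection r → polyAct r f - f ∈ J) :
    ∀ w ∈ W, polyAct w f - f ∈ J := by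
  have hW' : Subgroup.closure {g | g ∈ W ∧ IsReflection g} = W := hW
  intro w hw
  rw [← hW'] at hw
  induction hw using Subgroup.closure_induction with
  | mem x hx => exact hf x hx.1 hx.2
  | one => simp [polyAct_one]
  | mul x y hx hy ihx ihy =>
    rw [hW'] at hx
    have : polyAct (x * y) f - f = polyAct x (polyAct y f - f) + (polyAct x f - f) := by
      rw [polyAct_mul, map_sub]; ring
    rw [this]
    exact add_mem (hJ x hx ihy) ihx
  | inv x hx ih =>
    rw [hW'] at hx
    have : polyAct x⁻¹ f - f = -polyAct x⁻¹ (polyAct x f - f) := by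
      rw [map_sub, ← polyAct_mul, inv_mul_cancel, polyAct_one]; ring
    rw [this]
    exact neg_mem (hJ _ (inv_mem hx) ih)

/-- **Chevalley's lemma**, in a local form: in a relation with invariant coefficients, the cofactor
of a coefficient that does not lie locally at the origin in the ideal generated by the others is in
the ideal generated by the invariants without constant term. -/
theorem mem_invariantIdeal_of_relation [Fintype W] (hW : IsReflectionGroup W)
    {ι : Type*} (s : Finset ι) {g₀ : MvPolynomial (Fin n) ℂ} {g : ι → MvPolynomial (Fin n) ℂ}
    (hg₀ : g₀ ∈ invariants W) (hg : ∀ i ∈ s, g i ∈ invariants W)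
    (hno : ∀ u ∈ invariants W, ∀ k : ι → MvPolynomial (Fin n) ℂ, (∀ i, k i ∈ invariants W) →
      u * g₀ = ∑ i ∈ s, g i * k i → constantCoeff u = 0)
    (h₀ : MvPolynomial (Fin n) ℂ) (h : ι → MvPolynomial (Fin n) ℂ)
    (hrel : g₀ * h₀ + ∑ i ∈ s, g i * h i = 0) : h₀ ∈ invariantIdeal W := by
  induction hd : h₀.totalDegree using Nat.strong_induction_on generalizing h₀ h with
  | _ d ih =>
  subst hd
  -- Averaging the relation expresses `average W h₀ * g₀` through the `g i` with invariant
  -- coefficients, so `hno` kills its constant term.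
  have hav : average W h₀ ∈ invariantIdeal W := by
    refine mem_invariantIdeal_of_invariant (average_mem W h₀)
      (hno _ (average_mem W h₀) (fun i => -average W (h i))
        (fun i => neg_mem (average_mem W _)) ?_)
    have := congrArg (average W) hrel
    rw [map_add, map_sum, map_zero, average_mul W hg₀,
      Finset.sum_congr rfl fun i hi => average_mul W (hg i hi) (h i)] at this
    simp only [mul_neg, Finset.sum_neg_distrib]
    linear_combination this
  have hsub := sub_average_mem W (J := invariantIdeal W) (f := h₀) ?_
  · simpa using sub_mem hav hsub
  refine polyAct_sub_mem hW (fun w hw => polyAct_mem_invariantIdeal ⟨w, hw⟩) fun r hr href => ?_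
  have hfin : IsOfFinOrder r := by
    have := isOfFinOrder_of_finite (⟨r, hr⟩ : W)
    exact Submonoid.isOfFinOrder_coe.2 this
  -- Each difference under `r` is divisible by the linear form `l`. The quotients satisfy a relation
  -- with the same coefficients and `k₀` has lower degree than `h₀`, so induction applies.
  obtain ⟨l, hl0, hl1, hl⟩ := exists_dvd_polyAct_sub hfin href
  obtain ⟨k₀, hk₀⟩ := hl h₀
  choose k hk using fun i => hl (h i)
  rw [hk₀]
  refine Ideal.mul_mem_left _ _ ?_
  rcases eq_or_ne k₀ 0 with rfl | hk0
  · exact zero_mem _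
  refine ih k₀.totalDegree ?_ k₀ k ?_ rfl
  · have h1 : (l * k₀).totalDegree ≤ h₀.totalDegree := by
      rw [← hk₀]
      exact (totalDegree_sub _ _).trans (max_le (totalDegree_polyAct_le r h₀) le_rfl)
    rw [totalDegree_mul_of_isDomain hl0 hk0, hl1.totalDegree hl0] at h1
    omega
  · refine (mul_eq_zero.1 (?_ : l * _ = 0)).resolve_left hl0
    -- The relation minus its image under `r` is `l` times the relation for the quotients.
    have h1 := congrArg (polyAct r) hrel
    simp only [map_add, map_sum, map_mul, map_zero, mem_invariants.1 hg₀ r hr] at h1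
    rw [Finset.sum_congr rfl fun i hi => by rw [mem_invariants.1 (hg i hi) r hr]] at h1
    rw [mul_add, Finset.mul_sum]
    have h2 : ∀ i, l * (g i * k i) = g i * polyAct r (h i) - g i * h i := fun i => by
      linear_combination (-g i) * hk i
    simp only [h2, Finset.sum_sub_distrib]
    linear_combination h1 - hrel - g₀ * hk₀

/-- Polynomials that are linearly independent modulo the ideal generated by the invariants without
constant term are linearly independent over the invariants. -/
theorem coeff_eq_zero_of_relation [Fintype W] (hW : IsReflectionGroup W)
    {ι : Type*} (s : Finset ι) (h : ι → MvPolynomial (Fin n) ℂ)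
    (hind : ∀ c : ι → ℂ, ∑ i ∈ s, C (c i) * h i ∈ invariantIdeal W → ∀ i ∈ s, c i = 0)
    (g : ι → MvPolynomial (Fin n) ℂ) (hg : ∀ i ∈ s, g i ∈ invariants W)
    (hrel : ∑ i ∈ s, g i * h i = 0) : ∀ i ∈ s, g i = 0 := by
  classical
  induction s using Finset.induction_on generalizing h with
  | empty => simp
  | insert a s ha ih =>
  rw [Finset.sum_insert ha] at hrel
  have hga := hg a (Finset.mem_insert_self a s)
  have hgs : ∀ i ∈ s, g i ∈ invariants W := fun i hi => hg i (Finset.mem_insert_of_mem hi)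
  have hna : h a ∉ invariantIdeal W := fun hm => by
    have := hind (Pi.single a 1) ?_ a (Finset.mem_insert_self a s)
    · simp at this
    · rw [Finset.sum_insert ha, Finset.sum_eq_zero fun i hi => ?_]
      · simpa using hm
      · rw [Pi.single_eq_of_ne (ne_of_mem_of_not_mem hi ha)]; simp
  have hex : ∃ u ∈ invariants W, ∃ k : ι → MvPolynomial (Fin n) ℂ, (∀ i, k i ∈ invariants W) ∧
      u * g a = ∑ i ∈ s, g i * k i ∧ constantCoeff u ≠ 0 := by
    by_contra! hno
    exact hna (mem_invariantIdeal_of_relation hW s hga hgs hno (h a) h hrel)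
  obtain ⟨u, hu, k, hk, huk, hu0⟩ := hex
  have hC : ∀ f ∈ invariants W, f - C (constantCoeff f) ∈ invariantIdeal W := fun f hf =>
    mem_invariantIdeal_of_invariant (sub_mem hf ((invariants W).algebraMap_mem _)) (by simp)
  have hs0 : ∀ i ∈ s, g i = 0 := by
    -- Multiplying the relation by `u` and substituting for `u * g a` eliminates `g a`. Modulo the
    -- ideal the new cofactors are `u(0) h i + k i (0) h a`, still independent because `u(0) ≠ 0`;
    -- `c'` holds the resulting coefficients of the old cofactors.
    refine ih (fun i => u * h i + k i * h a) (fun c hc i hi => ?_) hgs ?_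
    · let c' : ι → ℂ := fun j => if j = a then ∑ i ∈ s, c i * constantCoeff (k i)
        else c j * constantCoeff u
      have hne : ∀ i ∈ s, i ≠ a := fun i hi h => ha (h ▸ hi)
      have := hind c' ?_ i (Finset.mem_insert_of_mem hi)
      · simp only [c', if_neg (hne i hi)] at this
        exact (mul_eq_zero.1 this).resolve_right hu0
      · rw [Finset.sum_insert ha]
        have e1 : ∑ i ∈ s, C (c' i) * h i = ∑ i ∈ s, C (c i) * (C (constantCoeff u) * h i) :=
          Finset.sum_congr rfl fun i hi => by
            simp only [c', if_neg (hne i hi), map_mul]; ring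
        have e2 : C (c' a) * h a = ∑ i ∈ s, C (c i) * (C (constantCoeff (k i)) * h a) := by
          simp only [c', if_true, map_sum, map_mul, Finset.sum_mul, mul_assoc]
        have e3 : C (c' a) * h a + ∑ i ∈ s, C (c' i) * h i
            = ∑ i ∈ s, C (c i) * (u * h i + k i * h a)
              - ∑ i ∈ s, C (c i) * ((u - C (constantCoeff u)) * h i
                + (k i - C (constantCoeff (k i))) * h a) := by
          rw [e1, e2, ← Finset.sum_add_distrib, ← Finset.sum_sub_distrib]
          exact Finset.sum_congr rfl fun i _ => by ring
        rw [e3]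
        exact sub_mem hc (sum_mem fun i _ => Ideal.mul_mem_left _ _
          (add_mem (Ideal.mul_mem_right _ _ (hC u hu)) (Ideal.mul_mem_right _ _ (hC _ (hk i)))))
    · have h3 : ∑ i ∈ s, g i * (u * h i + k i * h a)
          = u * ∑ i ∈ s, g i * h i + (∑ i ∈ s, g i * k i) * h a := by
        rw [Finset.mul_sum, Finset.sum_mul, ← Finset.sum_add_distrib]
        exact Finset.sum_congr rfl fun i _ => by ring
      rw [h3, ← huk]
      linear_combination u * hrel
  intro i hi
  rcases Finset.mem_insert.1 hi with rfl | hi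
  · rw [Finset.sum_eq_zero fun j hj => by rw [hs0 j hj, zero_mul]] at huk
    exact (mul_eq_zero.1 huk).resolve_left fun h => hu0 (by simp [h])
  · exact hs0 i hi

end Freeness

/-! ### The graded structure of the polynomial ring over the invariants -/

instance (d : ℕ) : FiniteDimensional ℂ (homogeneousSubmodule (Fin n) ℂ d) :=
  Module.Finite.iff_fg.2 (homogeneousSubmodule_fg _ _ d)

instance (W : Subgroup (GL (Fin n) ℂ)) (d : ℕ) : FiniteDimensional ℂ (coinvariantPiece W d) :=
  Module.Finite.map (homogeneousSubmodule (Fin n) ℂ d) _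

/-- The homogeneous invariants of degree `d`. -/
noncomputable def invariantPiece (W : Subgroup (GL (Fin n) ℂ)) (d : ℕ) :
    Submodule ℂ (MvPolynomial (Fin n) ℂ) :=
  Subalgebra.toSubmodule (invariants W) ⊓ homogeneousSubmodule (Fin n) ℂ d

instance (W : Subgroup (GL (Fin n) ℂ)) (d : ℕ) : FiniteDimensional ℂ (invariantPiece W d) :=
  Submodule.finiteDimensional_of_le (inf_le_right : _ ≤ homogeneousSubmodule (Fin n) ℂ d)

/-- The representation on the homogeneous polynomials of degree `d`. -/
noncomputable def polyRep (W : Subgroup (GL (Fin n) ℂ)) (d : ℕ) :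
    Representation ℂ W (homogeneousSubmodule (Fin n) ℂ d) where
  toFun w := (polyAct (w : GL (Fin n) ℂ)).toLinearMap.restrict fun _ hf =>
    polyAct_isHomogeneous (w : GL (Fin n) ℂ) hf
  map_one' := LinearMap.ext fun _ => Subtype.ext (polyAct_one _)
  map_mul' _ _ := LinearMap.ext fun _ => Subtype.ext (polyAct_mul _ _ _)

section Graded

variable {W : Subgroup (GL (Fin n) ℂ)}

@[simp]
theorem coe_polyRep (d : ℕ) (w : W) (f : homogeneousSubmodule (Fin n) ℂ d) :
    (polyRep W d w f : MvPolynomial (Fin n) ℂ) = polyAct (w : GL (Fin n) ℂ) f := rfl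

theorem homogeneousComponent_polyAct (g : GL (Fin n) ℂ) (d : ℕ) (f : MvPolynomial (Fin n) ℂ) :
    homogeneousComponent d (polyAct g f) = polyAct g (homogeneousComponent d f) := by
  have h : ∀ i, homogeneousComponent d (polyAct g (homogeneousComponent i f))
      = if d = i then polyAct g (homogeneousComponent i f) else 0 := fun i =>
    homogeneousComponent_of_mem
      (polyAct_isHomogeneous g (homogeneousComponent_isHomogeneous i f))
  nth_rw 1 [← sum_homogeneousComponent f]
  rw [map_sum, map_sum, Finset.sum_congr rfl fun i _ => h i, Finset.sum_ite_eq]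
  split_ifs with hd
  · rfl
  · rw [homogeneousComponent_eq_zero _ _ (by simpa [Nat.lt_succ_iff] using hd), map_zero]

theorem homogeneousComponent_mem_invariantPiece {f : MvPolynomial (Fin n) ℂ}
    (hf : f ∈ invariants W) (d : ℕ) : homogeneousComponent d f ∈ invariantPiece W d :=
  ⟨mem_invariants.2 fun w hw => by
    rw [← homogeneousComponent_polyAct, mem_invariants.1 hf w hw],
    homogeneousComponent_isHomogeneous d f⟩

/-- The ideal is generated by homogeneous invariants of positive degree. Writing that degree as `i +
1` makes the cofactor degree `j` strictly less than `d`, as the induction in `mem_span_mul_section`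
needs. -/
theorem homogeneousComponent_mem_span {f : MvPolynomial (Fin n) ℂ} (hf : f ∈ invariantIdeal W)
    (d : ℕ) : homogeneousComponent d f ∈ Submodule.span ℂ
      {x | ∃ i j, i + 1 + j = d ∧ ∃ u ∈ invariantPiece W (i + 1), ∃ q : MvPolynomial (Fin n) ℂ,
        q.IsHomogeneous j ∧ u * q = x} := by
  obtain ⟨k, q, u, rfl⟩ := Submodule.mem_span_set'.1 hf
  rw [map_sum]
  refine sum_mem fun a _ => ?_
  obtain ⟨u, hu, hu0⟩ := u a
  generalize q a = q
  change homogeneousComponent d (q * u) ∈ _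
  rw [← sum_homogeneousComponent q, ← sum_homogeneousComponent u, Finset.sum_mul_sum, map_sum]
  refine sum_mem fun j _ => ?_
  rw [map_sum]
  refine sum_mem fun i _ => ?_
  rw [homogeneousComponent_of_mem ((homogeneousComponent_isHomogeneous j q).mul
    (homogeneousComponent_isHomogeneous i u))]
  split_ifs with h
  · rcases i with _ | i
    · rw [homogeneousComponent_zero, ← constantCoeff_eq, hu0, map_zero, mul_zero]
      exact zero_mem _
    · exact Submodule.subset_span ⟨i, j, by omega, _,
        homogeneousComponent_mem_invariantPiece (mem_invariants.2 hu) _, _,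
        homogeneousComponent_isHomogeneous j q, mul_comm _ _⟩
  · exact zero_mem _

theorem homogeneousComponent_mem_invariantIdeal {f : MvPolynomial (Fin n) ℂ}
    (hf : f ∈ invariantIdeal W) (d : ℕ) : homogeneousComponent d f ∈ invariantIdeal W := by
  have hle : Submodule.span ℂ
      {x | ∃ i j, i + 1 + j = d ∧ ∃ u ∈ invariantPiece W (i + 1), ∃ q : MvPolynomial (Fin n) ℂ,
        q.IsHomogeneous j ∧ u * q = x} ≤ (invariantIdeal W).restrictScalars ℂ := by
    refine Submodule.span_le.2 ?_
    rintro _ ⟨i, j, -, u, hu, q, -, rfl⟩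
    refine Ideal.mul_mem_right _ _ (mem_invariantIdeal_of_invariant hu.1 ?_)
    rw [constantCoeff_eq]
    exact IsHomogeneous.coeff_eq_zero hu.2 (by simp)
  exact hle (homogeneousComponent_mem_span hf d)

/-- The homogeneous components of the coinvariant algebra lift equivariantly. -/
theorem exists_equivariant_section (W : Subgroup (GL (Fin n) ℂ)) [Fintype W] (d : ℕ) :
    ∃ s : coinvariantPiece W d →ₗ[ℂ] homogeneousSubmodule (Fin n) ℂ d,
      (∀ a, Ideal.Quotient.mk (invariantIdeal W) (s a) = a) ∧
      ∀ w a, polyRep W d w (s a) = s (coinvariantRep W d w a) := by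
  let π : homogeneousSubmodule (Fin n) ℂ d →ₗ[ℂ] coinvariantPiece W d :=
    (Ideal.Quotient.mkₐ ℂ (invariantIdeal W)).toLinearMap.restrict fun f hf => ⟨f, hf, rfl⟩
  have hπ : LinearMap.range π = ⊤ := by
    rw [LinearMap.range_eq_top]
    rintro ⟨_, f, hf, rfl⟩
    exact ⟨⟨f, hf⟩, rfl⟩
  have hπw : ∀ w f, π (polyRep W d w f) = coinvariantRep W d w (π f) := fun w f => rfl
  obtain ⟨s₀, hs₀⟩ := π.exists_rightInverse_of_surjective hπ
  have hs₀' : ∀ a, π (s₀ a) = a := fun a => LinearMap.congr_fun hs₀ a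
  have hc : (Fintype.card W : ℂ) ≠ 0 := Nat.cast_ne_zero.2 Fintype.card_ne_zero
  -- Maschke's averaging of a linear section over the group.
  obtain ⟨s, hs⟩ : ∃ s : coinvariantPiece W d →ₗ[ℂ] homogeneousSubmodule (Fin n) ℂ d, ∀ a, s a
      = (Fintype.card W : ℂ)⁻¹ • ∑ w : W, polyRep W d w (s₀ (coinvariantRep W d w⁻¹ a)) :=
    ⟨(Fintype.card W : ℂ)⁻¹ • ∑ w : W, polyRep W d w ∘ₗ s₀ ∘ₗ coinvariantRep W d w⁻¹,
      fun a => by simp⟩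
  have hπmk : ∀ f : homogeneousSubmodule (Fin n) ℂ d,
      Ideal.Quotient.mk (invariantIdeal W) (f : MvPolynomial (Fin n) ℂ) = π f := fun f => rfl
  refine ⟨s, fun a => ?_, fun w a => ?_⟩
  · rw [hπmk]
    refine congrArg Subtype.val ?_
    rw [hs, map_smul, map_sum]
    have : ∀ w : W, π (polyRep W d w (s₀ (coinvariantRep W d w⁻¹ a))) = a := fun w => by
      rw [hπw, hs₀', Representation.self_inv_apply]
    rw [Finset.sum_congr rfl fun w _ => this w, Finset.sum_const, Finset.card_univ,
      ← Nat.cast_smul_eq_nsmul ℂ, inv_smul_smul₀ hc]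
  · rw [hs, hs, map_smul, map_sum, ← Equiv.sum_comp (Equiv.mulLeft w)
      (fun v : W => polyRep W d v (s₀ (coinvariantRep W d v⁻¹ (coinvariantRep W d w a))))]
    refine congrArg _ (Finset.sum_congr rfl fun v _ => ?_)
    simp only [Equiv.coe_mulLeft, mul_inv_rev, map_mul, Module.End.mul_apply,
      Representation.inv_self_apply]

/-- The polynomial ring is spanned by the products of invariants with lifts of coinvariants. -/
theorem mem_span_mul_section
    (s : ∀ b, coinvariantPiece W b →ₗ[ℂ] homogeneousSubmodule (Fin n) ℂ b)
    (hs : ∀ b a, Ideal.Quotient.mk (invariantIdeal W) (s b a) = a)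
    (d : ℕ) {f : MvPolynomial (Fin n) ℂ} (hf : f.IsHomogeneous d) :
    f ∈ Submodule.span ℂ {x | ∃ a b, a + b = d ∧ ∃ u ∈ invariantPiece W a,
      ∃ y : coinvariantPiece W b, u * s b y = x} := by
  induction d using Nat.strong_induction_on generalizing f with
  | _ d ih =>
  let y : coinvariantPiece W d := ⟨Ideal.Quotient.mk (invariantIdeal W) f, f, hf, rfl⟩
  have hI : f - s d y ∈ invariantIdeal W := by
    rw [← Ideal.Quotient.eq_zero_iff_mem, map_sub, hs, sub_self]
  have hd : (f - s d y).IsHomogeneous d := hf.sub (s d y).2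
  have h1 := homogeneousComponent_mem_span hI d
  rw [homogeneousComponent_eq_self hd] at h1
  have h2 : (s d y : MvPolynomial (Fin n) ℂ) ∈ Submodule.span ℂ {x | ∃ a b, a + b = d ∧
      ∃ u ∈ invariantPiece W a, ∃ y : coinvariantPiece W b, u * s b y = x} :=
    Submodule.subset_span ⟨0, d, zero_add d, 1, ⟨one_mem (invariants W), isHomogeneous_one _ _⟩,
      y, one_mul _⟩
  rw [← sub_add_cancel f (s d y : MvPolynomial (Fin n) ℂ)]
  refine add_mem (Submodule.span_le.2 ?_ h1) h2
  rintro _ ⟨i, j, hij, u, hu, q, hq, rfl⟩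
  have h3 := ih j (by omega) hq
  suffices h4 : Submodule.span ℂ _ ≤ (Submodule.span ℂ {x | ∃ a b, a + b = d ∧
      ∃ u ∈ invariantPiece W a, ∃ y : coinvariantPiece W b, u * s b y = x}).comap
        (LinearMap.mulLeft ℂ u) from h4 h3
  refine Submodule.span_le.2 ?_
  rintro _ ⟨a, b, hab, v, hv, y, rfl⟩
  refine Submodule.subset_span ⟨i + 1 + a, b, by omega, u * v, ⟨(invariants W).mul_mem hu.1 hv.1, ?_⟩, y, ?_⟩
  · exact IsHomogeneous.mul hu.2 hv.2
  · simp [mul_assoc]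

/-- The trace on the polynomials of degree `d` in terms of the traces on the coinvariant
algebra. -/
theorem character_polyRep [Fintype W] (hW : IsReflectionGroup W) (d : ℕ) (w : W) :
    (polyRep W d).character w = ∑ b ∈ Finset.range (d + 1),
      (coinvariantRep W b).character w * Module.finrank ℂ (invariantPiece W (d - b)) := by
  classical
  choose s hs hsw using exists_equivariant_section W
  let p := fun a => Module.finBasis ℂ (invariantPiece W a)
  let q := fun b => Module.finBasis ℂ (coinvariantPiece W b)
  let h : (Σ b : Fin (d + 1), Fin (Module.finrank ℂ (coinvariantPiece W b))) →
      MvPolynomial (Fin n) ℂ := fun x => s x.1 (q x.1 x.2)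
  have hh : ∀ x, (h x).IsHomogeneous x.1 := fun x => (s x.1 (q x.1 x.2)).2
  have hind : ∀ c : (Σ b : Fin (d + 1), Fin (Module.finrank ℂ (coinvariantPiece W b))) → ℂ,
      ∑ x, C (c x) * h x ∈ invariantIdeal W → ∀ x ∈ Finset.univ, c x = 0 := by
    rintro c hc ⟨b, j⟩ -
    -- The ideal is homogeneous, so degrees separate; in degree `b` the relation descends to one
    -- between basis elements of the coinvariant piece.
    have h1 := homogeneousComponent_mem_invariantIdeal hc b
    rw [map_sum, Fintype.sum_sigma, Finset.sum_eq_single b] at h1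
    · have h2 : Ideal.Quotient.mk (invariantIdeal W) (∑ j, C (c ⟨b, j⟩) * h ⟨b, j⟩) = 0 := by
        rw [Ideal.Quotient.eq_zero_iff_mem]
        convert h1 using 2 with j
        rw [homogeneousComponent_eq_self ((hh ⟨b, j⟩).C_mul _)]
      have h3 : ∑ j, c ⟨b, j⟩ • q b j = 0 := by
        refine Subtype.ext ?_
        rw [map_sum] at h2
        simp only [h, ← smul_eq_C_mul] at h2
        rw [Submodule.coe_zero, ← h2, Submodule.coe_sum]
        refine Finset.sum_congr rfl fun j _ => ?_
        rw [Submodule.coe_smul, ← hs]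
        rfl
      exact Fintype.linearIndependent_iff.1 (q b).linearIndependent _ h3 j
    · intro b' _ hb'
      refine Finset.sum_eq_zero fun j _ => ?_
      rw [homogeneousComponent_of_mem ((hh ⟨b', j⟩).C_mul _), if_neg]
      exact fun h => hb' (Fin.ext h.symm)
    · simp
  -- The index type forces `b ≤ d`, so the subtraction `d - b` is not truncated.
  let v : (Σ b : Fin (d + 1), Fin (Module.finrank ℂ (invariantPiece W (d - b))) ×
      Fin (Module.finrank ℂ (coinvariantPiece W b))) → homogeneousSubmodule (Fin n) ℂ d :=
    fun x => ⟨(p (d - x.1) x.2.1 : MvPolynomial (Fin n) ℂ) * s x.1 (q x.1 x.2.2), by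
      have := IsHomogeneous.mul (p (d - x.1) x.2.1).2.2 (s x.1 (q x.1 x.2.2)).2
      rwa [Nat.sub_add_cancel (Nat.lt_succ_iff.1 x.1.2)] at this⟩
  have hli : LinearIndependent ℂ v := by
    refine Fintype.linearIndependent_iff.2 fun c hc => ?_
    -- Collecting the terms with the same coinvariant lift gives a relation with invariant
    -- coefficients.
    have h1 := coeff_eq_zero_of_relation hW Finset.univ h hind
      (fun x => ∑ i, c ⟨x.1, i, x.2⟩ • (p (d - x.1) i : MvPolynomial (Fin n) ℂ))
      (fun x _ => sum_mem fun i _ => (invariants W).smul_mem (p (d - x.1) i).2.1 _) ?_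
    · rintro ⟨b, i, j⟩
      have h2 := h1 ⟨b, j⟩ (Finset.mem_univ _)
      have h3 : ∑ i, c ⟨b, i, j⟩ • p (d - b) i = 0 := Subtype.ext (by simpa using h2)
      exact Fintype.linearIndependent_iff.1 (p (d - b)).linearIndependent _ h3 i
    · have h2 := congrArg Subtype.val hc
      rw [Submodule.coe_sum, Fintype.sum_sigma] at h2
      rw [Fintype.sum_sigma]
      refine Eq.trans ?_ h2
      refine Finset.sum_congr rfl fun b _ => ?_
      rw [Fintype.sum_prod_type_right]
      refine Finset.sum_congr rfl fun j _ => ?_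
      rw [Finset.sum_mul]
      exact Finset.sum_congr rfl fun i _ => by simp [v, h]
  have hsp : ⊤ ≤ Submodule.span ℂ (Set.range v) := by
    rintro ⟨f, hf⟩ -
    have h1 := mem_span_mul_section s hs d hf
    have h2 : f ∈ (Submodule.span ℂ (Set.range v)).map
        (homogeneousSubmodule (Fin n) ℂ d).subtype := by
      refine Submodule.span_le.2 ?_ h1
      rintro _ ⟨a, b, hab, u, hu, y, rfl⟩
      obtain rfl : a = d - b := by omega
      have hb : b < d + 1 := by omega
      have hu' : u = ∑ i, (p (d - b)).repr ⟨u, hu⟩ i • (p (d - b) i : MvPolynomial (Fin n) ℂ) := by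
        simpa only [Submodule.coe_sum, Submodule.coe_smul] using (congrArg Subtype.val ((p (d - b)).sum_repr ⟨u, hu⟩)).symm
      have hy' : (s b y : MvPolynomial (Fin n) ℂ)
          = ∑ j, (q b).repr y j • (s b (q b j) : MvPolynomial (Fin n) ℂ) := by
        have := congrArg (fun y => (s b y : MvPolynomial (Fin n) ℂ)) ((q b).sum_repr y).symm
        simpa only [map_sum, map_smul, Submodule.coe_sum, Submodule.coe_smul] using this
      rw [hu', hy', Finset.sum_mul_sum]
      refine sum_mem fun i _ => sum_mem fun j _ => ?_
      rw [smul_mul_smul_comm]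
      exact Submodule.smul_mem _ _ ⟨v ⟨⟨b, hb⟩, i, j⟩, Submodule.subset_span ⟨_, rfl⟩, rfl⟩
    obtain ⟨x, hx, hxf⟩ := h2
    rwa [show (⟨f, hf⟩ : homogeneousSubmodule (Fin n) ℂ d) = x from Subtype.ext hxf.symm]
  let B := Module.Basis.mk hli hsp
  have hB : ∀ x, B x = v x := fun x => by simp [B]
  -- The invariant factor is fixed and the section is equivariant, so each block is the coinvariant
  -- matrix repeated once for every basis invariant.
  have hw : ∀ b i j, polyRep W d w (B ⟨b, i, j⟩)
      = ∑ k, (q b).repr (coinvariantRep W b w (q b j)) k • B ⟨b, i, k⟩ := by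
    intro b i j
    refine Subtype.ext ?_
    have h1 := congrArg (fun y => (s b y : MvPolynomial (Fin n) ℂ))
      ((q b).sum_repr (coinvariantRep W b w (q b j)))
    simp only [map_sum, map_smul, Submodule.coe_sum, Submodule.coe_smul, ← hsw, coe_polyRep] at h1
    simp only [coe_polyRep, hB, Submodule.coe_sum, Submodule.coe_smul, v, map_mul, ← h1,
      Finset.mul_sum, mul_smul_comm]
    rw [mem_invariants.1 (p (d - b) i).2.1 w w.2]
  rw [Representation.character, LinearMap.trace_eq_matrix_trace ℂ B, Matrix.trace,
    Fintype.sum_sigma, ← Fin.sum_univ_eq_sum_range (fun b => (coinvariantRep W b).character w *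
      Module.finrank ℂ (invariantPiece W (d - b)))]
  refine Finset.sum_congr rfl fun b _ => ?_
  rw [Fintype.sum_prod_type, Representation.character, LinearMap.trace_eq_matrix_trace ℂ (q b),
    Matrix.trace]
  have hdiag : ∀ i j, (LinearMap.toMatrix B B (polyRep W d w)).diag ⟨b, i, j⟩
      = (LinearMap.toMatrix (q b) (q b) (coinvariantRep W b w)).diag j := fun i j => by
    rw [Matrix.diag_apply, LinearMap.toMatrix_apply, hw, map_sum, Finsupp.coe_finsetSum,
      Finset.sum_apply, Finset.sum_eq_single j]
    · simp [LinearMap.toMatrix_apply]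
    · intro k _ hk
      simp [hk]
    · simp
  simp only [hdiag, Finset.sum_const, Finset.card_univ, Fintype.card_fin, nsmul_eq_mul]
  rw [mul_comm]

end Graded

/-! ### Molien's formula -/

/-- In the coordinates given by `Q`, `g` scales the `i`-th variable by `z i`, so transported
monomials are eigenvectors. -/
theorem polyAct_diagonalization_monomial {g Q : GL (Fin n) ℂ} {z : Fin n → ℂ}
    (h : ((g⁻¹ : GL (Fin n) ℂ) : Matrix (Fin n) (Fin n) ℂ)
      = Q * Matrix.diagonal z * (Q⁻¹ : GL (Fin n) ℂ)) (m : Fin n →₀ ℕ) :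
    polyAct g (polyAct Q (monomial m 1)) = (∏ i, z i ^ m i) • polyAct Q (monomial m 1) := by
  refine MvPolynomial.funext fun v => ?_
  have h1 : ((Q⁻¹ : GL (Fin n) ℂ) : Matrix (Fin n) (Fin n) ℂ) * (g⁻¹ : GL (Fin n) ℂ)
      = Matrix.diagonal z * (Q⁻¹ : GL (Fin n) ℂ) := by
    rw [h, ← mul_assoc, ← mul_assoc, ← Units.val_mul, inv_mul_cancel, Units.val_one, one_mul]
  rw [eval_polyAct, eval_polyAct, smul_eval, eval_polyAct, Matrix.mulVec_mulVec, h1,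
    ← Matrix.mulVec_mulVec, eval_monomial, eval_monomial,
    Finsupp.prod_fintype _ _ fun i => pow_zero _, Finsupp.prod_fintype _ _ fun i => pow_zero _,
    one_mul, one_mul, ← Finset.prod_mul_distrib]
  exact Finset.prod_congr rfl fun i _ => by rw [Matrix.mulVec_diagonal, mul_pow]

theorem polyAct_inv_polyAct (g : GL (Fin n) ℂ) (f : MvPolynomial (Fin n) ℂ) :
    polyAct g⁻¹ (polyAct g f) = f := by
  rw [← polyAct_mul, inv_mul_cancel, polyAct_one]

theorem polyAct_polyAct_inv (g : GL (Fin n) ℂ) (f : MvPolynomial (Fin n) ℂ) :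
    polyAct g (polyAct g⁻¹ f) = f := by
  rw [← polyAct_mul, mul_inv_cancel, polyAct_one]

theorem degree_eq_of_mem_finsuppAntidiag {m : Fin n →₀ ℕ} {d : ℕ} :
    m ∈ Finset.univ.finsuppAntidiag d ↔ m.degree = d := by
  simp [Finset.mem_finsuppAntidiag, Finsupp.degree_eq_sum]

theorem character_polyRep_eq_sum {W : Subgroup (GL (Fin n) ℂ)} (w : W) {Q : GL (Fin n) ℂ}
    {z : Fin n → ℂ}
    (h : (((w : GL (Fin n) ℂ)⁻¹ : GL (Fin n) ℂ) : Matrix (Fin n) (Fin n) ℂ)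
      = Q * Matrix.diagonal z * (Q⁻¹ : GL (Fin n) ℂ)) (d : ℕ) :
    (polyRep W d).character w = ∑ m ∈ Finset.univ.finsuppAntidiag d, ∏ i, z i ^ m i := by
  let v : (Finset.univ : Finset (Fin n)).finsuppAntidiag d → homogeneousSubmodule (Fin n) ℂ d :=
    fun m => ⟨polyAct Q (monomial m 1), polyAct_isHomogeneous Q
      (isHomogeneous_monomial _ (degree_eq_of_mem_finsuppAntidiag.1 m.2))⟩
  have hli : LinearIndependent ℂ v := by
    refine LinearIndependent.of_comp (homogeneousSubmodule (Fin n) ℂ d).subtype ?_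
    have h1 : LinearIndependent ℂ fun m : (Finset.univ : Finset (Fin n)).finsuppAntidiag d =>
        (monomial (m : Fin n →₀ ℕ) (1 : ℂ) : MvPolynomial (Fin n) ℂ) := by
      have := (basisMonomials (Fin n) ℂ).linearIndependent.comp _
        (Subtype.val_injective (p := (· ∈ (Finset.univ : Finset (Fin n)).finsuppAntidiag d)))
      simpa [Function.comp_def] using this
    exact h1.map' (polyAct Q).toLinearMap (LinearMap.ker_eq_bot.2
      (Function.LeftInverse.injective (polyAct_inv_polyAct Q)))
  have hsp : ⊤ ≤ Submodule.span ℂ (Set.range v) := by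
    rintro ⟨f, hf⟩ -
    have hf' : (polyAct Q⁻¹ f).IsHomogeneous d := polyAct_isHomogeneous _ hf
    have h1 : f ∈ (Submodule.span ℂ (Set.range v)).map
        (homogeneousSubmodule (Fin n) ℂ d).subtype := by
      rw [← polyAct_polyAct_inv Q f, (polyAct Q⁻¹ f).as_sum, map_sum]
      refine sum_mem fun m hm => ?_
      have hmd : m ∈ Finset.univ.finsuppAntidiag d := by
        refine degree_eq_of_mem_finsuppAntidiag.2 (by_contra fun hne => ?_)
        exact mem_support_iff.1 hm (hf'.coeff_eq_zero hne)
      rw [← mul_one (coeff m _), ← smul_eq_mul, ← smul_monomial, map_smul]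
      exact Submodule.smul_mem _ _ ⟨v ⟨m, hmd⟩, Submodule.subset_span ⟨_, rfl⟩, rfl⟩
    obtain ⟨x, hx, hxf⟩ := h1
    rwa [show (⟨f, hf⟩ : homogeneousSubmodule (Fin n) ℂ d) = x from Subtype.ext hxf.symm]
  rw [Representation.character, trace_eq_sum_of_eigenbasis (Module.Basis.mk hli hsp)
    (fun m => ∏ i, z i ^ (m : Fin n →₀ ℕ) i) _ fun m => ?_,
    ← Finset.sum_coe_sort (Finset.univ.finsuppAntidiag d)]
  rw [Module.Basis.mk_apply]
  exact Subtype.ext (polyAct_diagonalization_monomial h m)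

theorem mk_pow_mul_one_sub (z : ℂ) :
    (PowerSeries.mk fun k => z ^ k) * (1 - PowerSeries.C z * PowerSeries.X) = 1 := by
  ext k
  rw [mul_sub, mul_one, map_sub, mul_comm (PowerSeries.C z), ← mul_assoc, PowerSeries.coeff_mul_C]
  rcases k with _ | k
  · simp
  · simp [PowerSeries.coeff_succ_mul_X, pow_succ, PowerSeries.coeff_one]

/-- The trace in degree `d` is the complete homogeneous symmetric polynomial in the `z i`, whose
generating series is a product of geometric series. -/
theorem molien {W : Subgroup (GL (Fin n) ℂ)} (w : W) {Q : GL (Fin n) ℂ} {z : Fin n → ℂ}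
    (h : (((w : GL (Fin n) ℂ)⁻¹ : GL (Fin n) ℂ) : Matrix (Fin n) (Fin n) ℂ)
      = Q * Matrix.diagonal z * (Q⁻¹ : GL (Fin n) ℂ)) :
    (PowerSeries.mk fun d => (polyRep W d).character w)
      * ∏ i, (1 - PowerSeries.C (z i) * PowerSeries.X) = 1 := by
  have h1 : (PowerSeries.mk fun d => (polyRep W d).character w)
      = ∏ i, PowerSeries.mk fun k => z i ^ k := by
    ext d
    rw [PowerSeries.coeff_prod, PowerSeries.coeff_mk, character_polyRep_eq_sum w h]
    simp only [PowerSeries.coeff_mk]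
  rw [h1, ← Finset.prod_mul_distrib]
  exact Finset.prod_eq_one fun i _ => mk_pow_mul_one_sub _

/-! ### The graded character of the coinvariant algebra -/

section GradedCharacter

variable (W : Subgroup (GL (Fin n) ℂ)) [Fintype W]

/-- The graded trace of `w` on the coinvariant algebra. -/
noncomputable def gradedTrace (w : W) : Polynomial ℂ :=
  ∑ d ∈ Finset.range (Fintype.card W), Polynomial.monomial d ((coinvariantRep W d).character w)

theorem coeff_gradedTrace (w : W) (d : ℕ) :
    (gradedTrace W w).coeff d = (coinvariantRep W d).character w := by
  simp only [gradedTrace, Polynomial.finsetSum_coeff, Polynomial.coeff_monomial,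
    Finset.sum_ite_eq', Finset.mem_range]
  split_ifs with h
  · rfl
  · have hb := coinvariantPiece_eq_bot W (not_lt.1 h)
    have : Subsingleton (coinvariantPiece W d) := by rw [hb]; infer_instance
    rw [Representation.character, Subsingleton.elim (coinvariantRep W d w) 0, map_zero]

theorem coe_gradedTrace_mul (hW : IsReflectionGroup W) (w : W) :
    (gradedTrace W w : PowerSeries ℂ)
      * PowerSeries.mk (fun d => (Module.finrank ℂ (invariantPiece W d) : ℂ))
      = PowerSeries.mk fun d => (polyRep W d).character w := by
  ext d
  rw [PowerSeries.coeff_mul, PowerSeries.coeff_mk, character_polyRep hW,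
    Finset.Nat.sum_antidiagonal_eq_sum_range_succ
      (fun i j => PowerSeries.coeff i (gradedTrace W w : PowerSeries ℂ) * PowerSeries.coeff j
        (PowerSeries.mk (fun d => (Module.finrank ℂ (invariantPiece W d) : ℂ))))]
  simp [coeff_gradedTrace]

/-- The graded trace of `w` is the graded dimension times `(1 - x) ^ n / det (1 - x w⁻¹)`. -/
theorem gradedTrace_mul_prod (hW : IsReflectionGroup W) (w : W) {Q : GL (Fin n) ℂ} {z : Fin n → ℂ}
    (h : (((w : GL (Fin n) ℂ)⁻¹ : GL (Fin n) ℂ) : Matrix (Fin n) (Fin n) ℂ)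
      = Q * Matrix.diagonal z * (Q⁻¹ : GL (Fin n) ℂ)) :
    gradedTrace W w * ∏ i, (1 - Polynomial.C (z i) * Polynomial.X)
      = gradedTrace W 1 * (1 - Polynomial.X) ^ n := by
  refine Polynomial.coe_injective ℂ ?_
  have h1 := molien w h
  have h2 := molien (1 : W) (Q := 1) (z := fun _ => 1) (by simp)
  rw [← coe_gradedTrace_mul W hW] at h1 h2
  have h3 : ((∏ i, (1 - Polynomial.C (z i) * Polynomial.X) : Polynomial ℂ) : PowerSeries ℂ)
      = ∏ i, (1 - PowerSeries.C (z i) * PowerSeries.X) := by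
    rw [← Polynomial.coeToPowerSeries.ringHom_apply, map_prod]
    simp
  rw [Polynomial.coe_mul, h3]
  simp only [map_one, one_mul, Finset.prod_const, Finset.card_univ, Fintype.card_fin] at h2
  simp only [Polynomial.coe_mul, Polynomial.coe_pow, Polynomial.coe_sub, Polynomial.coe_one,
    Polynomial.coe_X]
  set H := PowerSeries.mk (fun d => (Module.finrank ℂ (invariantPiece W d) : ℂ))
  -- Both denominators become `1` after multiplication by the same series `H` and the corresponding
  -- graded trace, so `H` drops out without being computed.
  linear_combination (-(gradedTrace W w : PowerSeries ℂ) *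
    ∏ i, (1 - PowerSeries.C (z i) * PowerSeries.X)) * h2
    + ((gradedTrace W 1 : PowerSeries ℂ) * (1 - PowerSeries.X) ^ n) * h1

/-- Cancelling the factors `1 - x` from eigenvalues `1` exposes the order of vanishing at `x = 1`.
-/
theorem gradedTrace_mul_prod_filter (hW : IsReflectionGroup W) (w : W) {Q : GL (Fin n) ℂ}
    {z : Fin n → ℂ} (h : (((w : GL (Fin n) ℂ)⁻¹ : GL (Fin n) ℂ) : Matrix (Fin n) (Fin n) ℂ)
      = Q * Matrix.diagonal z * (Q⁻¹ : GL (Fin n) ℂ)) (s : Finset (Fin n))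
    (hs : ∀ i, i ∉ s → z i = 1) :
    gradedTrace W w * ∏ i ∈ s, (1 - Polynomial.C (z i) * Polynomial.X)
      = gradedTrace W 1 * (1 - Polynomial.X) ^ s.card := by
  have h0 : (1 - Polynomial.X : Polynomial ℂ) ^ sᶜ.card ≠ 0 := by
    refine pow_ne_zero _ fun h => ?_
    simpa using congrArg (Polynomial.eval 0) h
  refine mul_right_cancel₀ h0 ?_
  have h1 := gradedTrace_mul_prod W hW w h
  rw [← Finset.prod_mul_prod_compl s, Finset.prod_congr (rfl : sᶜ = sᶜ) fun i hi => by
    rw [hs i (Finset.mem_compl.1 hi), map_one, one_mul], Finset.prod_const] at h1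
  rw [mul_assoc, h1, mul_assoc, ← pow_add, Finset.card_add_card_compl, Fintype.card_fin]

theorem eq_one_of_diagonalization {g Q : GL (Fin n) ℂ} {z : Fin n → ℂ}
    (h : ((g⁻¹ : GL (Fin n) ℂ) : Matrix (Fin n) (Fin n) ℂ)
      = Q * Matrix.diagonal z * (Q⁻¹ : GL (Fin n) ℂ)) (hz : ∀ i, z i = 1) : g = 1 := by
  rw [← inv_eq_one]
  refine Units.ext ?_
  rw [h, show z = fun _ => 1 from funext hz, Matrix.diagonal_one, mul_one, ← Units.val_mul,
    mul_inv_cancel]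

theorem exists_diagonalization_inv (w : W) : ∃ (Q : GL (Fin n) ℂ) (z : Fin n → ℂ),
    (((w : GL (Fin n) ℂ)⁻¹ : GL (Fin n) ℂ) : Matrix (Fin n) (Fin n) ℂ)
      = Q * Matrix.diagonal z * (Q⁻¹ : GL (Fin n) ℂ) :=
  exists_diagonalization (Submonoid.isOfFinOrder_coe.2 (isOfFinOrder_of_finite w)).inv

/-- The derivative at `1` of the graded trace of `w`. -/
noncomputable def gradedTraceDeriv (w : W) : ℂ :=
  (gradedTrace W w).derivative.eval 1

theorem gradedTrace_eval_one (hW : IsReflectionGroup W) {w : W} (hw : w ≠ 1) :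
    (gradedTrace W w).eval 1 = 0 := by
  obtain ⟨Q, z, hz⟩ := exists_diagonalization_inv W w
  let s : Finset (Fin n) := {i | z i ≠ 1}
  have h := gradedTrace_mul_prod_filter W hW w hz s (by simp [s])
  have hs : s.card ≠ 0 := fun h0 => hw <| Subtype.ext <| eq_one_of_diagonalization hz fun i => by
    by_contra hi
    have : i ∈ s := by simpa [s] using hi
    simp [Finset.card_eq_zero.1 h0] at this
  have h1 := congrArg (Polynomial.eval 1) h
  simp only [Polynomial.eval_mul, Polynomial.eval_prod, Polynomial.eval_sub, Polynomial.eval_one,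
    Polynomial.eval_C, Polynomial.eval_X, Polynomial.eval_pow, mul_one, sub_self,
    zero_pow hs, mul_zero] at h1
  refine (mul_eq_zero.1 h1).resolve_right (Finset.prod_ne_zero_iff.2 fun i hi => ?_)
  exact sub_ne_zero.2 (Ne.symm (by simpa [s] using hi))

/-- At least two eigenvalues differ from `1`, so the right side of `gradedTrace_mul_prod_filter` has
a double zero at `1`, while the cofactor of the graded trace does not vanish there. -/
theorem gradedTraceDeriv_eq_zero (hW : IsReflectionGroup W) {w : W} (hw : w ≠ 1)
    (hr : ¬ IsReflection (w : GL (Fin n) ℂ)) : gradedTraceDeriv W w = 0 := by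
  obtain ⟨Q, z, hz⟩ := exists_diagonalization_inv W w
  let s : Finset (Fin n) := {i | z i ≠ 1}
  have h := gradedTrace_mul_prod_filter W hW w hz s (by simp [s])
  have hs0 : s.card ≠ 0 := fun h0 => hw <| Subtype.ext <| eq_one_of_diagonalization hz fun i => by
    by_contra hi
    have : i ∈ s := by simpa [s] using hi
    simp [Finset.card_eq_zero.1 h0] at this
  have hs1 : s.card ≠ 1 := fun h1 => hr <| by
    obtain ⟨a, ha⟩ := Finset.card_eq_one.1 h1
    have hm : ∀ i, z i ≠ 1 ↔ i = a := fun i => by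
      rw [← Finset.mem_singleton, ← ha]; simp [s]
    exact (isReflection_iff_exists hz).2 ⟨a, (hm a).2 rfl, fun j hj => by
      by_contra hz; exact hj ((hm j).1 hz)⟩
  have h1 := congrArg (fun p => (Polynomial.derivative p).eval 1) h
  simp only [Polynomial.derivative_mul, Polynomial.eval_add, Polynomial.eval_mul,
    gradedTrace_eval_one W hW hw, Polynomial.derivative_pow, zero_mul, add_zero] at h1
  simp only [Polynomial.eval_prod, Polynomial.eval_sub, Polynomial.eval_one, Polynomial.eval_mul,
    Polynomial.eval_C, Polynomial.eval_X, Polynomial.eval_pow, mul_one, sub_self, zero_pow hs0,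
    zero_pow (show s.card - 1 ≠ 0 by omega), mul_zero, zero_mul, add_zero] at h1
  refine (mul_eq_zero.1 h1).resolve_right (Finset.prod_ne_zero_iff.2 fun i hi => ?_)
  exact sub_ne_zero.2 (Ne.symm (by simpa [s] using hi))

/-- The determinant of `w⁻¹` is its only eigenvalue other than `1`; the formula is the derivative at
`1` of `G_w(x) (1 - c x) = G_1(x) (1 - x)`. -/
theorem gradedTraceDeriv_mul (hW : IsReflectionGroup W) {w : W}
    (hr : IsReflection (w : GL (Fin n) ℂ)) :
    let c := Matrix.det (((w : GL (Fin n) ℂ)⁻¹ : GL (Fin n) ℂ) : Matrix (Fin n) (Fin n) ℂ)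
    c ≠ 1 ∧ gradedTraceDeriv W w * (1 - c) = -(gradedTrace W 1).eval 1 := by
  obtain ⟨Q, z, hz⟩ := exists_diagonalization_inv W w
  obtain ⟨a, ha, hu⟩ := (isReflection_iff_exists hz).1 hr
  have hc : Matrix.det (((w : GL (Fin n) ℂ)⁻¹ : GL (Fin n) ℂ) : Matrix (Fin n) (Fin n) ℂ)
      = z a := by
    rw [hz, Matrix.det_mul, Matrix.det_mul, mul_right_comm, ← Matrix.det_mul, ← Units.val_mul,
      mul_inv_cancel, Units.val_one, Matrix.det_one, one_mul, Matrix.det_diagonal,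
      Finset.prod_eq_single a (fun b _ hb => hu b hb) (by simp)]
  have hw : w ≠ 1 := by
    rintro rfl
    apply ha
    rw [← hc]
    simp
  have h := gradedTrace_mul_prod_filter W hW w hz {a} (by simpa using hu)
  rw [Finset.prod_singleton, Finset.card_singleton, pow_one] at h
  have h1 := congrArg (fun p => (Polynomial.derivative p).eval 1) h
  simp [gradedTrace_eval_one W hW hw] at h1
  intro c
  rw [show c = z a from hc]
  exact ⟨ha, h1⟩

theorem isReflection_inv {g : GL (Fin n) ℂ} : IsReflection g⁻¹ ↔ IsReflection g := by
  rw [IsReflection, IsReflection, fixedSpace_inv]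

/-- The determinants of `w` and `w⁻¹` are inverse to each other, and `1 / (1 - c) + 1 / (1 - c⁻¹) =
1`. -/
theorem gradedTraceDeriv_add_inv (hW : IsReflectionGroup W) {w : W}
    (hr : IsReflection (w : GL (Fin n) ℂ)) :
    gradedTraceDeriv W w + gradedTraceDeriv W w⁻¹ = -(gradedTrace W 1).eval 1 := by
  obtain ⟨hc, h1⟩ := gradedTraceDeriv_mul W hW hr
  obtain ⟨hc', h2⟩ := gradedTraceDeriv_mul W hW (w := w⁻¹) (isReflection_inv.2 hr)
  rw [Subgroup.coe_inv, inv_inv] at hc' h2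
  have hcc : Matrix.det (((w : GL (Fin n) ℂ)⁻¹ : GL (Fin n) ℂ) : Matrix (Fin n) (Fin n) ℂ)
      * Matrix.det ((w : GL (Fin n) ℂ) : Matrix (Fin n) (Fin n) ℂ) = 1 := by
    rw [← Matrix.det_mul, ← Units.val_mul, inv_mul_cancel, Units.val_one, Matrix.det_one]
  set c := Matrix.det (((w : GL (Fin n) ℂ)⁻¹ : GL (Fin n) ℂ) : Matrix (Fin n) (Fin n) ℂ)
  set c' := Matrix.det ((w : GL (Fin n) ℂ) : Matrix (Fin n) (Fin n) ℂ)
  have h3 : (1 - c) * (1 - c') ≠ 0 :=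
    mul_ne_zero (sub_ne_zero.2 hc.symm) (sub_ne_zero.2 hc'.symm)
  refine mul_right_cancel₀ h3 ?_
  linear_combination (1 - c') * h1 + (1 - c) * h2 + (gradedTrace W 1).eval 1 * hcc

theorem sum_mul_gradedTraceDeriv (hW : IsReflectionGroup W) (ψ : W → ℂ) :
    ∑ w, ψ w * (gradedTraceDeriv W w + gradedTraceDeriv W w⁻¹)
      = 2 * gradedTraceDeriv W 1 * ψ 1 - (gradedTrace W 1).eval 1 * ∑ r ∈ reflections W, ψ r := by
  classical
  have h1 : (1 : W) ∉ reflections W := by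
    intro h
    have h2 := (gradedTraceDeriv_mul W hW (w := 1) (by simpa [reflections] using h)).1
    simp at h2
  rw [← Finset.add_sum_erase _ _ (Finset.mem_univ (1 : W)), inv_one]
  have h2 : ∑ w ∈ Finset.univ.erase (1 : W), ψ w * (gradedTraceDeriv W w + gradedTraceDeriv W w⁻¹)
      = ∑ r ∈ reflections W, ψ r * (gradedTraceDeriv W r + gradedTraceDeriv W r⁻¹) := by
    refine (Finset.sum_subset (fun r hr => ?_) fun w hw hr => ?_).symm
    · exact Finset.mem_erase.2 ⟨fun h => h1 (h ▸ hr), Finset.mem_univ _⟩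
    · have hw1 := Finset.ne_of_mem_erase hw
      have hr' : ¬ IsReflection (w : GL (Fin n) ℂ) := by simpa [reflections] using hr
      rw [gradedTraceDeriv_eq_zero W hW hw1 hr', gradedTraceDeriv_eq_zero W hW (inv_ne_one.2 hw1)
        (fun h => hr' (isReflection_inv.1 h)), add_zero, mul_zero]
  have h3 : ∑ r ∈ reflections W, ψ r * (gradedTraceDeriv W r + gradedTraceDeriv W r⁻¹)
      = ∑ r ∈ reflections W, ψ r * -(gradedTrace W 1).eval 1 :=
    Finset.sum_congr rfl fun r hr => by
      rw [gradedTraceDeriv_add_inv W hW (by simpa [reflections] using hr)]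
  rw [h2, h3, ← Finset.sum_mul]
  ring

/-- Degree zero consists of the constants. In positive degree an orbit sum is an invariant without
constant term, hence zero among the coinvariants. -/
theorem sum_character_coinvariantRep (d : ℕ) :
    ∑ w, (coinvariantRep W d).character w = if d = 0 then (Fintype.card W : ℂ) else 0 := by
  split_ifs with hd
  · subst hd
    have hC : ∀ f ∈ homogeneousSubmodule (Fin n) ℂ 0, f = C (coeff 0 f) := fun f hf => by
      rw [← homogeneousComponent_zero, homogeneousComponent_eq_self hf]
    have h1 : ∀ w, coinvariantRep W 0 w = LinearMap.id := fun w => by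
      refine LinearMap.ext ?_
      rintro ⟨_, f, hf, rfl⟩
      refine Subtype.ext ?_
      change Ideal.Quotient.mk (invariantIdeal W) (polyAct (w : GL (Fin n) ℂ) f)
        = Ideal.Quotient.mk _ f
      rw [hC f hf, ← algebraMap_eq, AlgHom.commutes]
    have h2 : Module.finrank ℂ (coinvariantPiece W 0) = 1 := by
      refine finrank_eq_one_iff'.2 ⟨⟨1, 1, isHomogeneous_one _ _, rfl⟩, fun h => ?_, ?_⟩
      · have h3 : Ideal.Quotient.mk (invariantIdeal W) 1 = 0 := by
          rw [map_one]; exact congrArg Subtype.val h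
        have h4 := constantCoeff_eq_zero_of_mem (Ideal.Quotient.eq_zero_iff_mem.1 h3)
        simp at h4
      · rintro ⟨_, f, hf, rfl⟩
        refine ⟨coeff 0 f, Subtype.ext ?_⟩
        change coeff 0 f • (1 : CoinvariantAlgebra W) = Ideal.Quotient.mkₐ ℂ (invariantIdeal W) f
        rw [hC f hf, ← algebraMap_eq, AlgHom.commutes, algebraMap_eq, coeff_C, if_pos rfl]
        exact (Algebra.algebraMap_eq_smul_one _).symm
    simp [Representation.character, h1, LinearMap.trace_id, h2]
  · simp only [Representation.character]
    rw [← map_sum]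
    suffices h : ∑ w, coinvariantRep W d w = 0 by rw [h, map_zero]
    refine LinearMap.ext ?_
    rintro ⟨_, f, hf, rfl⟩
    refine Subtype.ext ?_
    have h0 : constantCoeff f = 0 := by
      rw [constantCoeff_eq]
      exact IsHomogeneous.coeff_eq_zero hf (by simpa using Ne.symm hd)
    have h1 := Ideal.Quotient.eq_zero_iff_mem.2 (sum_polyAct_mem_invariantIdeal W h0)
    rw [map_sum] at h1
    rw [LinearMap.sum_apply, Submodule.coe_sum]
    exact h1

theorem sum_gradedTrace : ∑ w, gradedTrace W w = Polynomial.C (Fintype.card W : ℂ) := by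
  ext d
  rw [Polynomial.finsetSum_coeff]
  simp only [coeff_gradedTrace, sum_character_coinvariantRep, Polynomial.coeff_C]

theorem gradedTrace_one_eval_one (hW : IsReflectionGroup W) :
    (gradedTrace W 1).eval 1 = Fintype.card W := by
  have h := congrArg (Polynomial.eval 1) (sum_gradedTrace W)
  rw [Polynomial.eval_finsetSum, Polynomial.eval_C, Finset.sum_eq_single 1
    (fun w _ hw => gradedTrace_eval_one W hW hw) (by simp)] at h
  exact h

/-- The sum of all graded traces is constant, so the derivatives sum to zero; the case `ψ = 1` of
`sum_mul_gradedTraceDeriv` then determines the term at the identity. -/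
theorem two_mul_gradedTraceDeriv_one (hW : IsReflectionGroup W) :
    2 * gradedTraceDeriv W 1 = Fintype.card W * (reflections W).card := by
  have h := congrArg (fun p => (Polynomial.derivative p).eval 1) (sum_gradedTrace W)
  simp only [Polynomial.derivative_sum, Polynomial.eval_finsetSum, Polynomial.derivative_C,
    Polynomial.eval_zero] at h
  have h1 := sum_mul_gradedTraceDeriv W hW fun _ => 1
  have h2 : ∑ w, gradedTraceDeriv W w = 0 := h
  simp only [one_mul, Finset.sum_add_distrib] at h1
  have h3 : ∑ w, gradedTraceDeriv W w⁻¹ = 0 :=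
    (Equiv.sum_comp (Equiv.inv W) (gradedTraceDeriv W)).trans h2
  rw [h2, h3, gradedTrace_one_eval_one W hW] at h1
  simp only [Finset.sum_const, nsmul_eq_mul, mul_one] at h1
  linear_combination -h1

/-! ### Fake degrees and the sum of the reflections -/

theorem fakeDegree_eq_sum (χ : W → ℂ) : fakeDegree W χ
    = Polynomial.C (Fintype.card W : ℂ)⁻¹
      * ∑ w, Polynomial.C (starRingEnd ℂ (χ w)) * gradedTrace W w := by
  ext d
  rw [coeff_fakeDegree, Polynomial.coeff_C_mul, Polynomial.finsetSum_coeff, multiplicity]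
  simp only [Polynomial.coeff_C_mul, coeff_gradedTrace]

theorem exponentSum_fakeDegree (χ : W → ℂ) : exponentSum (fakeDegree W χ)
    = (Fintype.card W : ℂ)⁻¹ * ∑ w, starRingEnd ℂ (χ w) * gradedTraceDeriv W w := by
  have h : exponentSum (fakeDegree W χ) = (fakeDegree W χ).derivative.eval 1 := by
    simp [exponentSum, Polynomial.derivative_eval]
  rw [h, fakeDegree_eq_sum]
  simp [Polynomial.derivative_mul, Polynomial.eval_finsetSum,
    gradedTraceDeriv]

theorem N_add_N_star (hW : IsReflectionGroup W) {χ : W → ℂ}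
    (hχ : ∀ w, starRingEnd ℂ (χ w) = χ w⁻¹) :
    N W χ + N W (star χ) = (reflections W).card * χ 1 - ∑ r ∈ reflections W, χ r := by
  have hc : (Fintype.card W : ℂ) ≠ 0 := Nat.cast_ne_zero.2 Fintype.card_ne_zero
  have h1 : N W χ = (Fintype.card W : ℂ)⁻¹ * ∑ w, χ w * gradedTraceDeriv W w := by
    rw [N, exponentSum_fakeDegree]
    simp
  -- The conjugate of `χ w` is `χ w⁻¹`; reindexing by inversion moves the inverse onto the graded
  -- trace.
  have h2 : N W (star χ) = (Fintype.card W : ℂ)⁻¹ * ∑ w, χ w * gradedTraceDeriv W w⁻¹ := by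
    rw [N, exponentSum_fakeDegree, star_star,
      ← Equiv.sum_comp (Equiv.inv W) fun w => χ w * gradedTraceDeriv W w⁻¹]
    simp [hχ]
  rw [h1, h2, ← mul_add, ← Finset.sum_add_distrib]
  simp_rw [← mul_add]
  rw [sum_mul_gradedTraceDeriv W hW, two_mul_gradedTraceDeriv_one W hW,
    gradedTrace_one_eval_one W hW]
  field_simp

theorem linearExtension_reflectionSum (χ : W → ℂ) :
    linearExtension χ (reflectionSum W) = ∑ r ∈ reflections W, χ r := by
  classical
  simp only [linearExtension, reflectionSum, MonoidAlgebra.coeff_sum, Finsupp.coe_finsetSum,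
    Finset.sum_apply, Finset.sum_mul]
  rw [Finset.sum_comm]
  refine Finset.sum_congr rfl fun r _ => ?_
  rw [Finset.sum_eq_single r (fun w _ hw => by simp [MonoidAlgebra.of_apply, hw]) (by simp)]
  simp [MonoidAlgebra.of_apply]

end GradedCharacter

end ReflectionGroup

theorem mainTheorem5 (n : ℕ) (W : Subgroup (GL (Fin n) ℂ)) [Fintype W]
    (hW : ReflectionGroup.IsReflectionGroup W)
    (e : ℕ) (he : ∀ H ∈ ReflectionGroup.reflectingHyperplanes W,
      Nat.card (ReflectionGroup.fixator W H) = e)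
    {V : Type*} [AddCommGroup V] [Module ℂ V] [FiniteDimensional ℂ V]
    (ρ : Representation ℂ W V) (hρ : ρ.IsIrreducible)
    (χ : W → ℂ) (hχ : χ = ρ.character) :
    ReflectionGroup.linearExtension χ (ReflectionGroup.reflectionSum W)
      = ((ReflectionGroup.reflections W).card : ℂ) * χ 1
        - ReflectionGroup.N W χ - ReflectionGroup.N W (star χ) := by
  have h := ReflectionGroup.N_add_N_star W hW (χ := χ) fun w => by
    rw [hχ, ReflectionGroup.star_character]
  rw [ReflectionGroup.linearExtension_reflectionSum]
  linear_combination h
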